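/- \textbf{Lemma (Gradient descent, convergence rate).} Consider the linear quadratic regulator with multiplicative noise (LQRm) $$x_{t+1}=\Big(A+\sum_{i=1}^p\delta_{it}A_i\Big)x_t+\Big(B+\sum_{j=1}^q\gamma_{jt}B_j\Big)u_t,\qquad J(K)=\mathbb E\sum_{t=0}^\infty\big(x_t^TQx_t+u_t^TRu_t\big),\quad u_t=Kx_t,$$ with $x_t\in\mathbb R^n$, $u_t\in\mathbb R^m$, $Q\succeq0$, $R\succ0$, where the $\delta_{it},\gamma_{jt}$ are mutually independent, identically distributed over time, zero-mean, square integrable with variances $\alpha_i,\beta_j$, and $x_0$ is square integrable, independent of the noise, with $\Sigma_0=\mathbb E[x_0x_0^T]\succ0$. A gain $K$ is mean-square stabilizing if $\mathbb E[x_tx_t^T]\to0$ under $u_t=Kx_t$ for every square-integrable initial state independent of the noise. A gain $K^*$ is optimal if it is mean-square stabilizing and minimizes $J$ over all mean-square stabilizing gains. Let $\Sigma_K=\mathbb E\sum_{t\ge0}x_tx_t^T$, let $\|\cdot\|$ be the spectral norm, $\sigma_{\min}$ the smallest singular value, and $\nabla_KJ$ the matrix of partial derivatives of $J$. There is a real polynomial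 $P$ in nine variables, not depending on the problem instance or its dimensions, with the following property. For every such problem, every mean-square stabilizing $K^{(0)}$, and $\tau\in\mathbb R$ put $$c(\tau)=1\Big/P\Big(\|A\|,\ \|B\|,\ \sum_i\alpha_i\|A_i\|^2,\ \sum_j\beta_j\|B_j\|^2,\ \|R\|,\ \tfrac1{\sigma_{\min}(R)},\ \tfrac1{\sigma_{\min}(\Sigma_0)},\ J(K^{(0)}),\ \tau\Big).$$ (i) If $K^*$ is an optimal gain, then the conclusion (C) below holds with $c_{pg}=c(\operatorname{tr}\Sigma_{K^*})$. (ii) If $Q\succ0$, then an optimal gain $K^*$ exists, and (C) holds with $c_{pg}=c\big(J(K^{(0)})/\sigma_{\min}(Q)\big)$, which involves only the problem data and $J(K^{(0)})$. (C) $c_{pg}>0$, and for every constant step size $0<\eta\le c_{pg}$ the iterates $K^{(k+1)}=K^{(k)}-\eta\nabla_KJ(K^{(k)})$ are all mean-square stabilizing with finite cost, $J$ is differentiable at each of them, for all $k\ge0$ $$J(K^{(k+1)})-J(K^*)\le\Big(1-\eta\,\frac{\sigma_{\min}(R)\,\sigma_{\min}(\Sigma_0)^2}{\|\Sigma_{K^*}\|}\Big)\big(J(K^{(k)})-J(K^*)\big),$$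 and $J(K^{(k)})\to J(K^*)$ and $K^{(k)}\to K^*$ as $k\to\infty$. (In dimension zero, a reciprocal or quotient with zero denominator is read as $0$.) -/

import Mathlib

open MeasureTheory ProbabilityTheory Filter Topology

noncomputable section

/-- Spectral norm (largest singular value, `ℓ²` operator norm) of a real matrix. -/
def specNorm {k l : ℕ} (M : Matrix (Fin k) (Fin l) ℝ) : ℝ :=
  ‖LinearMap.toContinuousLinearMap (Matrix.toEuclideanLin M)‖

/-- Smallest singular value of a square real matrix (singular values are listed in decreasing
order, starting with index `0`). -/
def sigmaMin {k : ℕ} (M : Matrix (Fin k) (Fin k) ℝ) : ℝ :=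
  (Matrix.toEuclideanLin M).singularValues (k - 1)

/-- Parameters of a linear quadratic regulator problem with multiplicative noise: state dimension
`n`, input dimension `m`, `p` noises on the state matrix and `q` noises on the input matrix.
`α i`, `β j` are the noise variances. -/
structure LQRm (n m p q : ℕ) where
  A : Matrix (Fin n) (Fin n) ℝ
  B : Matrix (Fin n) (Fin m) ℝ
  Ai : Fin p → Matrix (Fin n) (Fin n) ℝ
  Bj : Fin q → Matrix (Fin n) (Fin m) ℝ
  Q : Matrix (Fin n) (Fin n) ℝ
  R : Matrix (Fin m) (Fin m) ℝ
  α : Fin p → ℝ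
  β : Fin q → ℝ

/-- All scalar noise variables `δ i t`, `γ j t` as one family. -/
def noiseFamily {p q : ℕ} {Ω : Type*} (δ : Fin p → ℕ → Ω → ℝ) (γ : Fin q → ℕ → Ω → ℝ) :
    (Fin p ⊕ Fin q) × ℕ → Ω → ℝ :=
  fun a => Sum.elim (fun i => δ i a.2) (fun j => γ j a.2) a.1

/-- `x` is an admissible random initial state: square integrable and independent of the whole
noise. -/
structure IsInitialState {n p q : ℕ} {Ω : Type*} [MeasurableSpace Ω] (μ : Measure Ω)
    (δ : Fin p → ℕ → Ω → ℝ) (γ : Fin q → ℕ → Ω → ℝ) (x : Ω → Fin n → ℝ) : Prop where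
  measurable : Measurable x
  memLp : ∀ i, MemLp (fun ω => x ω i) 2 μ
  indep : IndepFun x (fun ω a => noiseFamily δ γ a ω) μ

namespace LQRm

variable {n m p q : ℕ} {Ω : Type*} [MeasurableSpace Ω]

/-- The multiplicative noises are mutually independent, identically distributed over time,
centered, and have the variances prescribed by the problem. -/
structure IsNoise (S : LQRm n m p q) (μ : Measure Ω)
    (δ : Fin p → ℕ → Ω → ℝ) (γ : Fin q → ℕ → Ω → ℝ) : Prop where
  measurable_δ : ∀ i t, Measurable (δ i t)
  measurable_γ : ∀ j t, Measurable (γ j t)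
  memLp_δ : ∀ i t, MemLp (δ i t) 2 μ
  memLp_γ : ∀ j t, MemLp (γ j t) 2 μ
  indep : iIndepFun (noiseFamily δ γ) μ
  identDistrib_δ : ∀ i t, IdentDistrib (δ i t) (δ i 0) μ μ
  identDistrib_γ : ∀ j t, IdentDistrib (γ j t) (γ j 0) μ μ
  mean_δ : ∀ i t, ∫ ω, δ i t ω ∂μ = 0
  mean_γ : ∀ j t, ∫ ω, γ j t ω ∂μ = 0
  var_δ : ∀ i t, variance (δ i t) μ = S.α i
  var_γ : ∀ j t, variance (γ j t) μ = S.β j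

/-- State trajectory started at the random vector `x` under the linear feedback `u_t = K x_t`. -/
def state (S : LQRm n m p q) (δ : Fin p → ℕ → Ω → ℝ) (γ : Fin q → ℕ → Ω → ℝ)
    (K : Matrix (Fin m) (Fin n) ℝ) (x : Ω → Fin n → ℝ) : ℕ → Ω → Fin n → ℝ
  | 0 => x
  | t + 1 => fun ω =>
      (S.A + ∑ i, δ i t ω • S.Ai i).mulVec (S.state δ γ K x t ω) +
      (S.B + ∑ j, γ j t ω • S.Bj j).mulVec (K.mulVec (S.state δ γ K x t ω))

/-- The gain `K` is mean-square stabilizing: `E[x_t x_tᵀ] → 0` along the closed loop, for every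
admissible initial state. -/
def MSStabilizing (S : LQRm n m p q) (μ : Measure Ω)
    (δ : Fin p → ℕ → Ω → ℝ) (γ : Fin q → ℕ → Ω → ℝ) (K : Matrix (Fin m) (Fin n) ℝ) : Prop :=
  ∀ x : Ω → Fin n → ℝ, IsInitialState μ δ γ x → ∀ i j,
    Tendsto (fun t => ∫ ω, S.state δ γ K x t ω i * S.state δ γ K x t ω j ∂μ) atTop (𝓝 0)

/-- Stage cost `xᵀ Q x + uᵀ R u`. -/
def stageCost (S : LQRm n m p q) (x : Fin n → ℝ) (u : Fin m → ℝ) : ℝ :=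
  x ⬝ᵥ S.Q.mulVec x + u ⬝ᵥ S.R.mulVec u

/-- The cost `E ∑ₜ (x_tᵀ Q x_t + u_tᵀ R u_t)` of the feedback `u_t = K x_t`, in `[0, ∞]`. -/
def costE (S : LQRm n m p q) (μ : Measure Ω)
    (δ : Fin p → ℕ → Ω → ℝ) (γ : Fin q → ℕ → Ω → ℝ) (x₀ : Ω → Fin n → ℝ)
    (K : Matrix (Fin m) (Fin n) ℝ) : ENNReal :=
  ∫⁻ ω, ∑' t, ENNReal.ofReal
    (S.stageCost (S.state δ γ K x₀ t ω) (K.mulVec (S.state δ γ K x₀ t ω))) ∂μ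

/-- The cost `J(K)` as a real number (meaningful where `costE` is finite). -/
def J (S : LQRm n m p q) (μ : Measure Ω)
    (δ : Fin p → ℕ → Ω → ℝ) (γ : Fin q → ℕ → Ω → ℝ) (x₀ : Ω → Fin n → ℝ)
    (K : Matrix (Fin m) (Fin n) ℝ) : ℝ :=
  (S.costE μ δ γ x₀ K).toReal

/-- The policy gradient `∇_K J(K)`: the matrix of partial derivatives of `J`. -/
def gradJ (S : LQRm n m p q) (μ : Measure Ω)
    (δ : Fin p → ℕ → Ω → ℝ) (γ : Fin q → ℕ → Ω → ℝ) (x₀ : Ω → Fin n → ℝ)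
    (K : Matrix (Fin m) (Fin n) ℝ) : Matrix (Fin m) (Fin n) ℝ :=
  Matrix.of fun i j => deriv (fun s : ℝ => S.J μ δ γ x₀ (K + s • Matrix.single i j 1)) 0

/-- Aggregate state covariance `Σ_K = E ∑ₜ x_t x_tᵀ`. -/
def aggCov (S : LQRm n m p q) (μ : Measure Ω)
    (δ : Fin p → ℕ → Ω → ℝ) (γ : Fin q → ℕ → Ω → ℝ) (x₀ : Ω → Fin n → ℝ)
    (K : Matrix (Fin m) (Fin n) ℝ) : Matrix (Fin n) (Fin n) ℝ :=
  Matrix.of fun i j => ∫ ω, ∑' t, S.state δ γ K x₀ t ω i * S.state δ γ K x₀ t ω j ∂μ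

/-- `K` is an optimal gain: mean-square stabilizing, and of least cost among the mean-square
stabilizing gains. -/
def IsOptimalGain (S : LQRm n m p q) (μ : Measure Ω)
    (δ : Fin p → ℕ → Ω → ℝ) (γ : Fin q → ℕ → Ω → ℝ) (x₀ : Ω → Fin n → ℝ)
    (K : Matrix (Fin m) (Fin n) ℝ) : Prop :=
  S.MSStabilizing μ δ γ K ∧
    ∀ K', S.MSStabilizing μ δ γ K' → S.costE μ δ γ x₀ K ≤ S.costE μ δ γ x₀ K'

/-- Exact policy gradient descent with constant step size `η`. -/
def pgIter (S : LQRm n m p q) (μ : Measure Ω)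
    (δ : Fin p → ℕ → Ω → ℝ) (γ : Fin q → ℕ → Ω → ℝ) (x₀ : Ω → Fin n → ℝ)
    (η : ℝ) (K₀ : Matrix (Fin m) (Fin n) ℝ) : ℕ → Matrix (Fin m) (Fin n) ℝ
  | 0 => K₀
  | k + 1 => S.pgIter μ δ γ x₀ η K₀ k - η • S.gradJ μ δ γ x₀ (S.pgIter μ δ γ x₀ η K₀ k)

end LQRm

/-- Second moment matrix `Σ₀ = E[x₀ x₀ᵀ]`. -/
def secondMoment {n : ℕ} {Ω : Type*} [MeasurableSpace Ω] (μ : Measure Ω) (x₀ : Ω → Fin n → ℝ) :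
    Matrix (Fin n) (Fin n) ℝ :=
  Matrix.of fun i j => ∫ ω, x₀ ω i * x₀ ω j ∂μ

namespace LQRm

variable {n m p q : ℕ} {Ω : Type*} [MeasurableSpace Ω]

/-- `c` is a valid bound on the step size for policy gradient descent from `K₀`: it is positive,
and for every step size `0 < η ≤ c` the iterates stay mean-square stabilizing with finite,
differentiable cost, the suboptimality gap contracts in each step by the factor
`1 - η σ_min(R) σ_min(Σ₀)² / ‖Σ_{K*}‖`, and the costs and the gains converge to the optimal ones. -/
def LinearConvergenceUpTo (S : LQRm n m p q) (μ : Measure Ω)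
    (δ : Fin p → ℕ → Ω → ℝ) (γ : Fin q → ℕ → Ω → ℝ) (x₀ : Ω → Fin n → ℝ)
    (K₀ Kstar : Matrix (Fin m) (Fin n) ℝ) (c : ℝ) : Prop :=
  0 < c ∧ ∀ η : ℝ, 0 < η → η ≤ c →
    (∀ k : ℕ,
      S.MSStabilizing μ δ γ (S.pgIter μ δ γ x₀ η K₀ k) ∧
      S.costE μ δ γ x₀ (S.pgIter μ δ γ x₀ η K₀ k) ≠ ⊤ ∧
      DifferentiableAt ℝ (S.J μ δ γ x₀) (S.pgIter μ δ γ x₀ η K₀ k) ∧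
      S.J μ δ γ x₀ (S.pgIter μ δ γ x₀ η K₀ (k + 1)) - S.J μ δ γ x₀ Kstar ≤
        (1 - η * (sigmaMin S.R * sigmaMin (secondMoment μ x₀) ^ 2 /
            specNorm (S.aggCov μ δ γ x₀ Kstar))) *
          (S.J μ δ γ x₀ (S.pgIter μ δ γ x₀ η K₀ k) - S.J μ δ γ x₀ Kstar)) ∧
    Tendsto (fun k => S.J μ δ γ x₀ (S.pgIter μ δ γ x₀ η K₀ k)) atTop (𝓝 (S.J μ δ γ x₀ Kstar)) ∧
    Tendsto (S.pgIter μ δ γ x₀ η K₀) atTop (𝓝 Kstar)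

/-- The scalars in which the step size bound is expressed: norms of the problem data,
the (reciprocals of the) smallest singular values of `R` and `Σ₀`, the initial cost, and `τ`. -/
def sizeVector (S : LQRm n m p q) (μ : Measure Ω)
    (δ : Fin p → ℕ → Ω → ℝ) (γ : Fin q → ℕ → Ω → ℝ) (x₀ : Ω → Fin n → ℝ)
    (K₀ : Matrix (Fin m) (Fin n) ℝ) (τ : ℝ) : Fin 9 → ℝ :=
  ![specNorm S.A, specNorm S.B,
    ∑ i, S.α i * specNorm (S.Ai i) ^ 2, ∑ j, S.β j * specNorm (S.Bj j) ^ 2,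
    specNorm S.R, (sigmaMin S.R)⁻¹, (sigmaMin (secondMoment μ x₀))⁻¹,
    S.J μ δ γ x₀ K₀, τ]

end LQRm

end

/-!
Second moments turn the stochastic problem into a deterministic one. Since the noises at time `t`
are centred, uncorrelated and independent of the state `xₜ`, the matrix `Xₜ = E[xₜ xₜᵀ]` evolves
by the completely positive map `X ↦ ∑ₐ Cₐ X Cₐᵀ`, where `Cₐ = Aₐ + Bₐ K` runs over the nominal
closed loop and over the noise directions scaled by their standard deviations
(`IsNoise.secondMoment_succ`). Mean-square stabilization means that the powers of this map tend to
zero (`IsNoise.msStabilizing_iff`). In that case the Lyapunov equations for the aggregate second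
moment `Σ_K` and the value matrix `P_K` are uniquely solvable, and
`J(K) = tr((Q + Kᵀ R K) Σ_K) = tr(P_K Σ₀)`.

Everything rests on the exact expansion of the cost (`MomentLQR.Regular.cost_add`)
`J(K + Δ) - J(K) = 2 tr(E_K Σ_{K+Δ} Δᵀ) + tr(H_K Δ Σ_{K+Δ} Δᵀ)`, in which `H_K ≥ R`.
* Bounding the right-hand side below by completing the square gives gradient dominance,
  `J(K) - J(K*) ≤ ‖Σ_{K*}‖ ‖E_K‖² / σ_min(R)`.
* Bounding it above, with a Lipschitz estimate for `K ↦ Σ_K`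
  (`MomentLQR.Regular.cov_add_sub_form`), shows that `J` is differentiable with gradient
  `2 E_K Σ_K`, and that a small gradient step decreases `J` by `η / 2` times the squared gradient
  (`MomentLQR.Regular.descent`). As `‖∇J‖ ≥ 2 σ_min(Σ₀) ‖E_K‖`, this and gradient dominance give the
  contraction of the suboptimality.
* At an optimal gain `E_{K*} = 0`, so the expansion there gives quadratic growth
  `J(K) - J(K*) ≥ σ_min(R) σ_min(Σ₀) ‖K - K*‖²`, hence convergence of the gains.

The step size is uniform because every quantity entering the estimates is bounded on a sublevel set
of `J` by a polynomial in the given scalars. Traces of positive semidefinite matrices and Frobenius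
norms are used throughout, so that no dimension enters. The trace of the solution `Y` of
`Y = ∑ₐ Cₐᵀ Y Cₐ + 1` measures the stability margin of a gain: by Young's inequality `Y` remains a
Lyapunov certificate for nearby gains (`MomentLQR.cert_form_le`). The delicate bound is the one on
`tr Σ_K`, since `Q` may be singular. By quadratic growth, the closed loop of `K` is the one of `K*`
driven by an input of energy at most `J(K) / σ_min(R)`, and the certificate of `K*` then bounds
`tr Σ_K` (`MomentLQR.Regular.trace_cov_le`).

If `Q` is positive definite, the certificates are bounded on a sublevel set of `J`, so its gains
have a common radius of stability. The sublevel set is therefore compact, and an optimal gain exists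
(`MomentLQR.Regular.exists_isOpt`).
-/

noncomputable section

open Matrix

namespace LQRm

/-! ### Euclidean and Frobenius norms, positive semidefinite forms -/

section LinearAlgebra

/-- Euclidean norm of a vector of `k → ℝ` (whose own norm is the sup norm). -/
def en {k : Type*} [Fintype k] (v : k → ℝ) : ℝ := ‖WithLp.toLp 2 v‖

/-- Frobenius norm of a matrix. -/
def frob {k l : Type*} [Fintype k] [Fintype l] (M : Matrix k l ℝ) : ℝ :=
  en fun ij : k × l => M ij.1 ij.2

variable {k l r : Type*} [Fintype k] [Fintype l] [Fintype r]

lemma en_nonneg (v : k → ℝ) : 0 ≤ en v := norm_nonneg _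

lemma en_sq (v : k → ℝ) : en v ^ 2 = v ⬝ᵥ v := by
  rw [en, EuclideanSpace.norm_sq_eq]
  simp [dotProduct, sq]

lemma en_add_le (u v : k → ℝ) : en (u + v) ≤ en u + en v := by
  simpa [en] using norm_add_le (WithLp.toLp 2 u) (WithLp.toLp 2 v)

lemma en_smul (c : ℝ) (v : k → ℝ) : en (c • v) = |c| * en v := by
  simp [en, norm_smul]

lemma abs_dotProduct_le (u v : k → ℝ) : |u ⬝ᵥ v| ≤ en u * en v := by
  have := abs_real_inner_le_norm (WithLp.toLp 2 u) (WithLp.toLp 2 v)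
  simpa [en, PiLp.inner_apply, dotProduct, mul_comm] using this

lemma dotProduct_le_en (u v : k → ℝ) : u ⬝ᵥ v ≤ en u * en v :=
  (le_abs_self _).trans (abs_dotProduct_le u v)

lemma en_le_of_sq_le {v : k → ℝ} {c : ℝ} (hc : 0 ≤ c) (h : v ⬝ᵥ v ≤ c ^ 2) : en v ≤ c :=
  le_of_sq_le_sq (by rwa [en_sq]) hc

lemma frob_nonneg (M : Matrix k l ℝ) : 0 ≤ frob M := en_nonneg _

lemma frob_sq (M : Matrix k l ℝ) : frob M ^ 2 = ∑ i, en (M i) ^ 2 := by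
  rw [frob, en_sq]
  simp only [en_sq, dotProduct, Fintype.sum_prod_type]

lemma frob_sq_eq_trace (M : Matrix k l ℝ) : frob M ^ 2 = (Mᵀ * M).trace := by
  rw [frob, en_sq, Matrix.trace_mul_comm]
  simp only [dotProduct, Fintype.sum_prod_type, Matrix.trace, Matrix.diag, Matrix.mul_apply,
    Matrix.transpose_apply]

lemma frob_add_le (M N : Matrix k l ℝ) : frob (M + N) ≤ frob M + frob N :=
  en_add_le (fun ij : k × l => M ij.1 ij.2) (fun ij : k × l => N ij.1 ij.2)

lemma frob_smul (c : ℝ) (M : Matrix k l ℝ) : frob (c • M) = |c| * frob M :=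
  en_smul c (fun ij : k × l => M ij.1 ij.2)

lemma frob_zero : frob (0 : Matrix k l ℝ) = 0 := by
  simpa using frob_smul 0 (0 : Matrix k l ℝ)

lemma frob_sum_le {ι : Type*} (s : Finset ι) (M : ι → Matrix k l ℝ) :
    frob (∑ a ∈ s, M a) ≤ ∑ a ∈ s, frob (M a) := by
  classical
  induction s using Finset.induction_on with
  | empty => simp [frob_zero]
  | insert a s ha ih =>
    rw [Finset.sum_insert ha, Finset.sum_insert ha]
    exact (frob_add_le _ _).trans (by gcongr)

lemma eq_zero_of_frob_eq_zero {M : Matrix k l ℝ} (h : frob M = 0) : M = 0 := by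
  have h1 : WithLp.toLp 2 (fun ij : k × l => M ij.1 ij.2) = 0 := norm_eq_zero.mp h
  ext i j
  have := congrArg (fun w => w.ofLp (i, j)) h1
  simpa using this

lemma abs_apply_le_frob (M : Matrix k l ℝ) (i : k) (j : l) : |M i j| ≤ frob M := by
  have := PiLp.norm_apply_le (WithLp.toLp 2 (fun ij : k × l => M ij.1 ij.2)) (i, j)
  simpa [frob, en] using this

lemma frob_transpose (M : Matrix k l ℝ) : frob Mᵀ = frob M := by
  have : frob Mᵀ ^ 2 = frob M ^ 2 := by
    rw [frob_sq_eq_trace, frob_sq_eq_trace, Matrix.transpose_transpose, Matrix.trace_mul_comm]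
  exact (sq_eq_sq₀ (frob_nonneg _) (frob_nonneg _)).mp this

/-- If `M` acts with operator norm at most `c`, then `‖M N‖_F ≤ c ‖N‖_F`. -/
lemma frob_mul_le_of_bound {M : Matrix k l ℝ} {c : ℝ} (hc : 0 ≤ c)
    (h : ∀ v, en (M *ᵥ v) ≤ c * en v) (N : Matrix l r ℝ) : frob (M * N) ≤ c * frob N := by
  have key : frob (M * N) ^ 2 ≤ (c * frob N) ^ 2 := by
    rw [← frob_transpose, ← frob_transpose N, frob_sq, mul_pow, frob_sq, Finset.mul_sum]
    refine Finset.sum_le_sum fun j _ => ?_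
    have e : (M * N)ᵀ j = M *ᵥ (Nᵀ j) := by
      ext i; simp [Matrix.mul_apply, Matrix.mulVec, dotProduct]
    rw [e, ← mul_pow]
    exact pow_le_pow_left₀ (en_nonneg _) (h _) 2
  exact le_of_sq_le_sq key (mul_nonneg hc (frob_nonneg _))

lemma en_mulVec_le_frob (M : Matrix k l ℝ) (v : l → ℝ) : en (M *ᵥ v) ≤ frob M * en v := by
  refine en_le_of_sq_le (mul_nonneg (frob_nonneg _) (en_nonneg _)) ?_
  rw [mul_pow, frob_sq, Finset.sum_mul]
  refine Finset.sum_le_sum fun i _ => ?_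
  rw [← mul_pow, ← sq]
  exact sq_le_sq.mpr ((abs_dotProduct_le (M i) v).trans (le_abs_self _))

lemma frob_mul_le (M : Matrix k l ℝ) (N : Matrix l r ℝ) : frob (M * N) ≤ frob M * frob N :=
  frob_mul_le_of_bound (frob_nonneg _) (en_mulVec_le_frob M) N

/-- A bound on the bilinear form of `D` bounds the trace pairing with Frobenius norms. -/
lemma abs_trace_mul_le_of_form {D : Matrix k k ℝ} {x : ℝ}
    (h : ∀ u v, |u ⬝ᵥ D *ᵥ v| ≤ x * en u * en v) (E F : Matrix l k ℝ) :
    |(E * D * Fᵀ).trace| ≤ x * (frob E * frob F) := by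
  have e : (E * D * Fᵀ).trace = ∑ i, E i ⬝ᵥ D *ᵥ F i := by
    simp only [Matrix.trace, Matrix.diag]
    refine Finset.sum_congr rfl fun i _ => ?_
    rw [Matrix.mul_assoc, Matrix.mul_apply]
    simp only [dotProduct, Matrix.mulVec, Matrix.mul_apply, Matrix.transpose_apply]
  rw [e]
  rcases isEmpty_or_nonempty k with hk | ⟨⟨i₀⟩⟩
  · have h0 : frob E = 0 := by
      have := frob_sq E
      simp only [en_sq, dotProduct_of_isEmpty, Finset.sum_const_zero] at this
      simpa using this
    simp [h0]
  classical
  have hx : 0 ≤ x := by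
    have := (abs_nonneg _).trans (h (Pi.single i₀ 1) (Pi.single i₀ 1))
    have e1 : en (Pi.single i₀ (1 : ℝ)) ^ 2 = 1 := by rw [en_sq]; simp
    nlinarith
  calc |∑ i, E i ⬝ᵥ D *ᵥ F i| ≤ ∑ i, |E i ⬝ᵥ D *ᵥ F i| := Finset.abs_sum_le_sum_abs _ _
    _ ≤ ∑ i, x * (en (E i) * en (F i)) :=
        Finset.sum_le_sum fun i _ => by rw [← mul_assoc]; exact h _ _
    _ = x * ∑ i, en (E i) * en (F i) := by rw [Finset.mul_sum]
    _ ≤ x * (frob E * frob F) := by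
        refine mul_le_mul_of_nonneg_left ?_ hx
        refine le_of_sq_le_sq ?_ (mul_nonneg (frob_nonneg _) (frob_nonneg _))
        rw [mul_pow, frob_sq, frob_sq]
        exact Finset.sum_mul_sq_le_sq_mul_sq _ _ _

open scoped MatrixOrder in
lemma exists_eq_transpose_mul_self {X : Matrix k k ℝ} (hX : X.PosSemidef) :
    ∃ Z : Matrix k k ℝ, X = Zᵀ * Z := by
  classical
  obtain ⟨Z, hZ⟩ := CStarAlgebra.nonneg_iff_eq_star_mul_self.mp hX.nonneg
  exact ⟨Z, by simpa [Matrix.star_eq_conjTranspose] using hZ⟩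

lemma posSemidef_transpose_mul_self (Z : Matrix l k ℝ) : (Zᵀ * Z).PosSemidef := by
  simpa using Matrix.posSemidef_conjTranspose_mul_self Z

lemma posSemidef_conj {X : Matrix k k ℝ} (hX : X.PosSemidef) (C : Matrix l k ℝ) :
    (C * X * Cᵀ).PosSemidef := by
  simpa using hX.mul_mul_conjTranspose_same C

lemma form_nonneg {X : Matrix k k ℝ} (hX : X.PosSemidef) (v : k → ℝ) : 0 ≤ v ⬝ᵥ X *ᵥ v := by
  simpa using hX.dotProduct_mulVec_nonneg v

lemma form_transpose_mul (Z : Matrix l k ℝ) (u v : k → ℝ) :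
    u ⬝ᵥ (Zᵀ * Z) *ᵥ v = (Z *ᵥ u) ⬝ᵥ (Z *ᵥ v) := by
  rw [← Matrix.mulVec_mulVec, Matrix.dotProduct_mulVec, Matrix.vecMul_transpose]

/-- The trace pairing with a positive semidefinite matrix is monotone in the quadratic form. -/
lemma trace_mul_nonneg_of_form {M X : Matrix k k ℝ} (hM : ∀ v, 0 ≤ v ⬝ᵥ M *ᵥ v)
    (hX : X.PosSemidef) : 0 ≤ (M * X).trace := by
  obtain ⟨Z, rfl⟩ := exists_eq_transpose_mul_self hX
  have : (M * (Zᵀ * Z)).trace = ∑ i, Z i ⬝ᵥ M *ᵥ Z i := by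
    rw [← Matrix.mul_assoc, Matrix.trace_mul_comm]
    simp only [Matrix.trace, Matrix.diag, Matrix.mul_apply, dotProduct, Matrix.mulVec,
      Matrix.transpose_apply]
  rw [this]
  exact Finset.sum_nonneg fun i _ => hM _

lemma trace_mul_mono_of_form {M N X : Matrix k k ℝ} (h : ∀ v, v ⬝ᵥ M *ᵥ v ≤ v ⬝ᵥ N *ᵥ v)
    (hX : X.PosSemidef) : (M * X).trace ≤ (N * X).trace := by
  have := trace_mul_nonneg_of_form (M := N - M) (fun v => by
    rw [Matrix.sub_mulVec, dotProduct_sub]; linarith [h v]) hX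
  rw [Matrix.sub_mul, Matrix.trace_sub] at this
  linarith

lemma abs_form_le_trace {X : Matrix k k ℝ} (hX : X.PosSemidef) (u v : k → ℝ) :
    |u ⬝ᵥ X *ᵥ v| ≤ X.trace * en u * en v := by
  obtain ⟨Z, rfl⟩ := exists_eq_transpose_mul_self hX
  rw [form_transpose_mul, ← frob_sq_eq_trace]
  calc _ ≤ en (Z *ᵥ u) * en (Z *ᵥ v) := abs_dotProduct_le _ _
    _ ≤ (frob Z * en u) * (frob Z * en v) :=
        mul_le_mul (en_mulVec_le_frob _ _) (en_mulVec_le_frob _ _) (en_nonneg _)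
          (mul_nonneg (frob_nonneg _) (en_nonneg _))
    _ = _ := by ring

lemma form_le_trace {X : Matrix k k ℝ} (hX : X.PosSemidef) (v : k → ℝ) :
    v ⬝ᵥ X *ᵥ v ≤ X.trace * (v ⬝ᵥ v) := by
  have := (le_abs_self _).trans (abs_form_le_trace hX v v)
  rwa [mul_assoc, ← sq, en_sq] at this

lemma frob_le_trace {X : Matrix k k ℝ} (hX : X.PosSemidef) : frob X ≤ X.trace := by
  obtain ⟨Z, rfl⟩ := exists_eq_transpose_mul_self hX
  refine (frob_mul_le _ _).trans ?_
  rw [frob_transpose, ← frob_sq_eq_trace, sq]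

lemma form_symm {X : Matrix k k ℝ} (hX : X.PosSemidef) (u v : k → ℝ) :
    u ⬝ᵥ X *ᵥ v = v ⬝ᵥ X *ᵥ u := by
  obtain ⟨Z, rfl⟩ := exists_eq_transpose_mul_self hX
  rw [form_transpose_mul, form_transpose_mul, dotProduct_comm]

/-- Young's inequality for a positive semidefinite form, with weights `1 + ε` and `1 + κ`,
where `ε κ = 1`. -/
lemma form_add_le {X : Matrix k k ℝ} (hX : X.PosSemidef) {ε κ : ℝ} (hε : 0 < ε)
    (h : ε * κ = 1) (u v : k → ℝ) :
    (u + v) ⬝ᵥ X *ᵥ (u + v) ≤ (1 + ε) * (u ⬝ᵥ X *ᵥ u) + (1 + κ) * (v ⬝ᵥ X *ᵥ v) := by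
  have h0 := form_nonneg hX (ε • u - v)
  have hκ : 0 ≤ κ := by
    by_contra hc
    nlinarith
  have h1 := mul_nonneg hκ h0
  simp only [Matrix.mulVec_sub, Matrix.mulVec_add, dotProduct_sub, sub_dotProduct, dotProduct_add,
    add_dotProduct, Matrix.mulVec_smul, dotProduct_smul, smul_dotProduct, smul_eq_mul] at h1 ⊢
  rw [form_symm hX v u] at h1 ⊢
  have e : κ * (ε * (ε * (u ⬝ᵥ X *ᵥ u)) - ε * (u ⬝ᵥ X *ᵥ v) - (ε * (u ⬝ᵥ X *ᵥ v) - v ⬝ᵥ X *ᵥ v)) =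
    (ε * κ) * (ε * (u ⬝ᵥ X *ᵥ u)) - 2 * (ε * κ) * (u ⬝ᵥ X *ᵥ v) + κ * (v ⬝ᵥ X *ᵥ v) := by ring
  have h2 : 0 ≤ ε * (u ⬝ᵥ X *ᵥ u) - 2 * (u ⬝ᵥ X *ᵥ v) + κ * (v ⬝ᵥ X *ᵥ v) := by
    rw [h] at e
    linarith
  linarith

/-- If `X ≥ c`, then `‖E X‖_F ≥ c ‖E‖_F`. -/
lemma frob_le_frob_mul_of_form {X : Matrix k k ℝ} (hX : X.PosSemidef) {c : ℝ}
    (h : ∀ v, c * (v ⬝ᵥ v) ≤ v ⬝ᵥ X *ᵥ v) (E : Matrix l k ℝ) :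
    c * frob E ≤ frob (E * X) := by
  rcases le_or_gt c 0 with hc | hc
  · exact (mul_nonpos_of_nonpos_of_nonneg hc (frob_nonneg _)).trans (frob_nonneg _)
  refine le_of_sq_le_sq ?_ (frob_nonneg _)
  rw [mul_pow, frob_sq, frob_sq, Finset.mul_sum]
  refine Finset.sum_le_sum fun i _ => ?_
  rw [← mul_pow]
  refine pow_le_pow_left₀ (mul_nonneg hc.le (en_nonneg _)) ?_ 2
  have e : (E * X) i = X *ᵥ E i := by
    have hs : Xᵀ = X := by simpa using hX.isHermitian.eq
    have : (E * X) i = (E i) ᵥ* X := by ext j; simp [Matrix.mul_apply, Matrix.vecMul, dotProduct]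
    rw [this, ← Matrix.mulVec_transpose, hs]
  rw [e]
  rcases (en_nonneg (E i)).eq_or_lt with h0 | h0
  · rw [← h0, mul_zero]; exact en_nonneg _
  · have h1 := (h (E i)).trans (dotProduct_le_en (E i) (X *ᵥ E i))
    rw [← en_sq] at h1
    refine le_of_mul_le_mul_left ?_ h0
    linarith

lemma frob_sq_le_trace_of_form {M : Matrix k k ℝ} {c : ℝ} (h : ∀ v, c * (v ⬝ᵥ v) ≤ v ⬝ᵥ M *ᵥ v)
    (F : Matrix l k ℝ) : c * frob F ^ 2 ≤ (F * M * Fᵀ).trace := by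
  classical
  have := trace_mul_mono_of_form (M := c • 1) (N := M) (X := Fᵀ * F) (fun v => by
    simpa [Matrix.smul_mulVec] using h v) (posSemidef_transpose_mul_self F)
  rw [Matrix.trace_mul_comm, ← Matrix.mul_assoc]
  rw [Matrix.trace_mul_comm M] at this
  simpa [frob_sq_eq_trace] using this

end LinearAlgebra

/-! ### Spectral norm and smallest singular value -/

section Spectral

variable {k l : ℕ}

lemma specNorm_nonneg (M : Matrix (Fin k) (Fin l) ℝ) : 0 ≤ specNorm M := norm_nonneg _

lemma en_mulVec_le_specNorm (M : Matrix (Fin k) (Fin l) ℝ) (v : Fin l → ℝ) :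
    en (M *ᵥ v) ≤ specNorm M * en v := by
  have := (LinearMap.toContinuousLinearMap (Matrix.toEuclideanLin M)).le_opNorm (WithLp.toLp 2 v)
  simpa [specNorm, en] using this

lemma en_transpose_mulVec_le_specNorm (M : Matrix (Fin k) (Fin l) ℝ) (v : Fin k → ℝ) :
    en (Mᵀ *ᵥ v) ≤ specNorm M * en v := by
  rcases (en_nonneg (Mᵀ *ᵥ v)).eq_or_lt with h0 | h0
  · rw [← h0]; exact mul_nonneg (specNorm_nonneg _) (en_nonneg _)
  refine le_of_mul_le_mul_left ?_ h0
  rw [← sq, en_sq]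
  calc (Mᵀ *ᵥ v) ⬝ᵥ (Mᵀ *ᵥ v) = v ⬝ᵥ M *ᵥ (Mᵀ *ᵥ v) := by
        rw [Matrix.dotProduct_mulVec v, ← Matrix.mulVec_transpose]
    _ ≤ en v * en (M *ᵥ (Mᵀ *ᵥ v)) := dotProduct_le_en _ _
    _ ≤ en v * (specNorm M * en (Mᵀ *ᵥ v)) := by
        gcongr
        · exact en_nonneg _
        · exact en_mulVec_le_specNorm _ _
    _ = _ := by ring

lemma specNorm_smul (c : ℝ) (M : Matrix (Fin k) (Fin l) ℝ) :
    specNorm (c • M) = |c| * specNorm M := by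
  simp [specNorm, norm_smul]

lemma specNorm_zero : specNorm (0 : Matrix (Fin k) (Fin l) ℝ) = 0 := by
  simp [specNorm]

lemma abs_form_le_specNorm (M : Matrix (Fin k) (Fin k) ℝ) (u v : Fin k → ℝ) :
    |u ⬝ᵥ M *ᵥ v| ≤ specNorm M * en u * en v := by
  calc _ ≤ en u * en (M *ᵥ v) := abs_dotProduct_le _ _
    _ ≤ en u * (specNorm M * en v) := by
        gcongr
        · exact en_nonneg _
        · exact en_mulVec_le_specNorm _ _
    _ = _ := by ring

lemma form_le_specNorm (M : Matrix (Fin k) (Fin k) ℝ) (v : Fin k → ℝ) :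
    v ⬝ᵥ M *ᵥ v ≤ specNorm M * (v ⬝ᵥ v) := by
  have := (le_abs_self _).trans (abs_form_le_specNorm M v v)
  rwa [mul_assoc, ← sq, en_sq] at this

lemma sigmaMin_nonneg (M : Matrix (Fin k) (Fin k) ℝ) : 0 ≤ sigmaMin M :=
  LinearMap.singularValues_nonneg _ _

lemma sigmaMin_sq_le_of_hasEigenvalue {M : Matrix (Fin k) (Fin k) ℝ} {t : ℝ}
    (h : Module.End.HasEigenvalue ((LinearMap.adjoint (Matrix.toEuclideanLin M)) ∘ₗ
      (Matrix.toEuclideanLin M)) t) : sigmaMin M ^ 2 ≤ t := by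
  set T := Matrix.toEuclideanLin M
  obtain ⟨i, hi⟩ := T.isSymmetric_adjoint_comp_self.exists_eigenvalues_eq rfl h
  have hk : Module.finrank ℝ (EuclideanSpace ℝ (Fin k)) = k := by simp
  have hi' : (i : ℕ) < k := by have := i.2; omega
  have h1 : T.singularValues i ^ 2 = t := by
    rw [T.sq_singularValues_fin rfl i]; simpa using hi
  rw [← h1]
  refine pow_le_pow_left₀ (sigmaMin_nonneg _) ?_ 2
  exact T.singularValues_antitone (by omega)

/-- A positive semidefinite matrix is bounded below by its smallest singular value `s`: for every
eigenvalue `t` of `M - s`, the number `(t + s)²` is an eigenvalue of `Mᵀ M`, so `t + s ≥ s`. -/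
lemma sigmaMin_form_le {M : Matrix (Fin k) (Fin k) ℝ} (hM : M.PosSemidef) (v : Fin k → ℝ) :
    sigmaMin M * (v ⬝ᵥ v) ≤ v ⬝ᵥ M *ᵥ v := by
  set s := sigmaMin M
  have hH : (M - s • (1 : Matrix (Fin k) (Fin k) ℝ)).IsHermitian :=
    hM.isHermitian.sub (by simp [Matrix.IsHermitian])
  have hs : Mᵀ = M := by simpa using hM.isHermitian.eq
  have hP : (M - s • (1 : Matrix (Fin k) (Fin k) ℝ)).PosSemidef := by
    rw [hH.posSemidef_iff_eigenvalues_nonneg]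
    intro i
    set t := hH.eigenvalues i
    have hv := hH.mulVec_eigenvectorBasis i
    set w := hH.eigenvectorBasis i
    have hw0 : w ≠ 0 := hH.eigenvectorBasis.orthonormal.ne_zero i
    have hMw : M *ᵥ w.ofLp = (t + s) • w.ofLp := by
      rw [Matrix.sub_mulVec, Matrix.smul_mulVec, Matrix.one_mulVec] at hv
      rw [add_smul, ← hv]; simp
    have hTw : Matrix.toEuclideanLin M w = (t + s) • w := by
      ext j; simpa using congrFun hMw j
    have hww : 0 < w.ofLp ⬝ᵥ w.ofLp := by
      rw [← en_sq]
      have : 0 < en w.ofLp := by simpa [en] using hw0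
      positivity
    have hts : 0 ≤ t + s := by
      have := form_nonneg hM w.ofLp
      rw [hMw, dotProduct_smul, smul_eq_mul] at this
      exact nonneg_of_mul_nonneg_left this hww
    have hadj : LinearMap.adjoint (Matrix.toEuclideanLin M) = Matrix.toEuclideanLin M := by
      rw [← Matrix.toEuclideanLin_conjTranspose_eq_adjoint]; simp [hs]
    have hev : Module.End.HasEigenvalue ((LinearMap.adjoint (Matrix.toEuclideanLin M)) ∘ₗ
        (Matrix.toEuclideanLin M)) ((t + s) ^ 2) := by
      refine Module.End.hasEigenvalue_of_hasEigenvector (x := w) ⟨?_, hw0⟩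
      rw [Module.End.mem_eigenspace_iff, hadj]
      simp [hTw, smul_smul, sq]
    have := sigmaMin_sq_le_of_hasEigenvalue hev
    have h2 := le_of_sq_le_sq this hts
    show (0 : ℝ) ≤ t
    linarith
  have := form_nonneg hP v
  rw [Matrix.sub_mulVec, Matrix.smul_mulVec, Matrix.one_mulVec, dotProduct_sub, dotProduct_smul,
    smul_eq_mul] at this
  linarith

lemma sigmaMin_pos {M : Matrix (Fin k) (Fin k) ℝ} (hM : M.PosDef) (hk : 0 < k) :
    0 < sigmaMin M := by
  have hinj : Function.Injective (Matrix.toEuclideanLin M) := by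
    rw [← LinearMap.ker_eq_bot, LinearMap.ker_eq_bot']
    intro w hw
    by_contra h0
    have h1 : w.ofLp ≠ 0 := fun h => h0 (by ext j; simpa using congrFun h j)
    have h2 := hM.dotProduct_mulVec_pos h1
    have h3 : M *ᵥ w.ofLp = 0 := by
      have := congrArg WithLp.ofLp hw
      simpa using this
    rw [h3] at h2
    simp at h2
  exact (LinearMap.injective_iff_forall_lt_finrank_singularValues_pos _).mp hinj (k - 1)
    (by simp; omega)

end Spectral

/-! ### Completely positive maps and Lyapunov equations -/

section Kraus

variable {ι : Type*} [Fintype ι] {n : ℕ}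

/-- The completely positive map `X ↦ ∑ₐ Cₐ X Cₐᵀ` on matrices. -/
def krausOp (C : ι → Matrix (Fin n) (Fin n) ℝ) :
    Module.End ℝ (Matrix (Fin n) (Fin n) ℝ) where
  toFun X := ∑ a, C a * X * (C a)ᵀ
  map_add' X Y := by simp [Matrix.mul_add, Matrix.add_mul, Finset.sum_add_distrib]
  map_smul' c X := by simp [Finset.smul_sum]

/-- The dual family `a ↦ Cₐᵀ`, whose completely positive map is the adjoint for the trace
pairing. -/
def adjFamily (C : ι → Matrix (Fin n) (Fin n) ℝ) : ι → Matrix (Fin n) (Fin n) ℝ :=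
  fun a => (C a)ᵀ

/-- Mean-square stability of a family: the powers of its completely positive map tend to zero. -/
def Stable (C : ι → Matrix (Fin n) (Fin n) ℝ) : Prop :=
  ∀ X, Tendsto (fun t => (krausOp C ^ t) X) atTop (𝓝 0)

/-- The resolvent `(1 - krausOp C)⁻¹`, i.e. the solution operator of the Lyapunov equation
`Z = krausOp C Z + X` (zero if `1 - krausOp C` is singular). -/
def lyap (C : ι → Matrix (Fin n) (Fin n) ℝ) : Module.End ℝ (Matrix (Fin n) (Fin n) ℝ) :=
  Ring.inverse (1 - krausOp C)

variable {C : ι → Matrix (Fin n) (Fin n) ℝ}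

lemma krausOp_apply (C : ι → Matrix (Fin n) (Fin n) ℝ) (X : Matrix (Fin n) (Fin n) ℝ) :
    krausOp C X = ∑ a, C a * X * (C a)ᵀ := rfl

lemma krausOp_form (C : ι → Matrix (Fin n) (Fin n) ℝ) (X : Matrix (Fin n) (Fin n) ℝ)
    (u v : Fin n → ℝ) :
    u ⬝ᵥ krausOp C X *ᵥ v = ∑ a, ((C a)ᵀ *ᵥ u) ⬝ᵥ X *ᵥ ((C a)ᵀ *ᵥ v) := by
  rw [krausOp_apply, Matrix.sum_mulVec, dotProduct_sum]
  refine Finset.sum_congr rfl fun a _ => ?_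
  rw [← Matrix.mulVec_mulVec, ← Matrix.mulVec_mulVec, Matrix.dotProduct_mulVec u,
    Matrix.mulVec_transpose (C a) u]

lemma krausOp_dual_form (C : ι → Matrix (Fin n) (Fin n) ℝ) (X : Matrix (Fin n) (Fin n) ℝ)
    (u v : Fin n → ℝ) :
    u ⬝ᵥ krausOp (adjFamily C) X *ᵥ v = ∑ a, (C a *ᵥ u) ⬝ᵥ X *ᵥ (C a *ᵥ v) := by
  rw [krausOp_form]; simp [adjFamily]

lemma krausOp_posSemidef {X : Matrix (Fin n) (Fin n) ℝ} (hX : X.PosSemidef) :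
    (krausOp C X).PosSemidef :=
  Matrix.posSemidef_sum _ fun _ _ => posSemidef_conj hX _

lemma krausOp_pow_posSemidef {X : Matrix (Fin n) (Fin n) ℝ} (hX : X.PosSemidef) (t : ℕ) :
    ((krausOp C ^ t) X).PosSemidef := by
  induction t with
  | zero => simpa using hX
  | succ t ih =>
    rw [pow_succ', Module.End.mul_apply]
    exact krausOp_posSemidef ih

lemma trace_mul_krausOp (Y X : Matrix (Fin n) (Fin n) ℝ) :
    (Y * krausOp C X).trace = (krausOp (adjFamily C) Y * X).trace := by
  simp only [krausOp_apply, Matrix.mul_sum, Matrix.sum_mul, Matrix.trace_sum, adjFamily,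
    Matrix.transpose_transpose]
  refine Finset.sum_congr rfl fun a _ => ?_
  rw [← Matrix.mul_assoc, ← Matrix.mul_assoc, Matrix.trace_mul_comm, ← Matrix.mul_assoc,
    ← Matrix.mul_assoc]

lemma trace_mul_krausOp_pow (Y X : Matrix (Fin n) (Fin n) ℝ) (t : ℕ) :
    (Y * (krausOp C ^ t) X).trace = ((krausOp (adjFamily C) ^ t) Y * X).trace := by
  induction t generalizing X with
  | zero => simp
  | succ t ih =>
    rw [pow_succ, Module.End.mul_apply, ih, trace_mul_krausOp, pow_succ', Module.End.mul_apply]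

/-- If `X` dominates the bilinear form of `Y`, this persists under a completely positive map. -/
lemma form_dominated_krausOp_pow {X Y : Matrix (Fin n) (Fin n) ℝ}
    (h : ∀ u v, 2 * |u ⬝ᵥ Y *ᵥ v| ≤ u ⬝ᵥ X *ᵥ u + v ⬝ᵥ X *ᵥ v) (t : ℕ) (u v : Fin n → ℝ) :
    2 * |u ⬝ᵥ (krausOp C ^ t) Y *ᵥ v| ≤
      u ⬝ᵥ (krausOp C ^ t) X *ᵥ u + v ⬝ᵥ (krausOp C ^ t) X *ᵥ v := by
  induction t generalizing u v with
  | zero => simpa using h u v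
  | succ t ih =>
    rw [pow_succ', Module.End.mul_apply, Module.End.mul_apply, krausOp_form, krausOp_form,
      krausOp_form, ← Finset.sum_add_distrib]
    calc _ ≤ 2 * ∑ a, |((C a)ᵀ *ᵥ u) ⬝ᵥ (krausOp C ^ t) Y *ᵥ ((C a)ᵀ *ᵥ v)| := by
          gcongr; exact Finset.abs_sum_le_sum_abs _ _
      _ ≤ _ := by
          rw [Finset.mul_sum]
          exact Finset.sum_le_sum fun a _ => ih _ _

/-- Any matrix is dominated by a multiple of the identity. -/
lemma form_dominated_by_frob (Y : Matrix (Fin n) (Fin n) ℝ) (u v : Fin n → ℝ) :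
    2 * |u ⬝ᵥ Y *ᵥ v| ≤ u ⬝ᵥ (frob Y • (1 : Matrix (Fin n) (Fin n) ℝ)) *ᵥ u +
      v ⬝ᵥ (frob Y • (1 : Matrix (Fin n) (Fin n) ℝ)) *ᵥ v := by
  simp only [Matrix.smul_mulVec, Matrix.one_mulVec, dotProduct_smul, smul_eq_mul, ← en_sq]
  have h1 := abs_dotProduct_le u (Y *ᵥ v)
  have h2 := mul_le_mul_of_nonneg_left (en_mulVec_le_frob Y v) (en_nonneg u)
  nlinarith [mul_nonneg (frob_nonneg Y) (sq_nonneg (en u - en v))]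

lemma form_single (M : Matrix (Fin n) (Fin n) ℝ) (i j : Fin n) :
    (Pi.single i (1 : ℝ)) ⬝ᵥ M *ᵥ (Pi.single j 1) = M i j := by
  simp

lemma diag_le_trace {X : Matrix (Fin n) (Fin n) ℝ} (hX : X.PosSemidef) (i : Fin n) :
    X i i ≤ X.trace :=
  Finset.single_le_sum (f := fun i => X i i) (fun _ _ => hX.diag_nonneg) (Finset.mem_univ i)

/-- Stability only has to be tested on the trace of the orbit of the identity. -/
lemma stable_of_trace_one
    (h : Tendsto (fun t => ((krausOp C ^ t) 1).trace) atTop (𝓝 0)) : Stable C := by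
  intro Y
  refine tendsto_pi_nhds.mpr fun i => tendsto_pi_nhds.mpr fun j => ?_
  have h' : Tendsto (fun t => frob Y * ((krausOp C ^ t) 1).trace) atTop (𝓝 0) := by
    simpa using h.const_mul (frob Y)
  refine squeeze_zero_norm (fun t => ?_) h'
  have h1 := form_dominated_krausOp_pow (C := C) (form_dominated_by_frob Y) t
    (Pi.single i 1) (Pi.single j 1)
  rw [form_single, form_single, form_single, map_smul, Matrix.smul_apply, Matrix.smul_apply,
    smul_eq_mul, smul_eq_mul] at h1
  have hP := krausOp_pow_posSemidef (C := C) (Matrix.PosSemidef.one (n := Fin n) (R := ℝ)) t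
  have h2 := mul_le_mul_of_nonneg_left (diag_le_trace hP i) (frob_nonneg Y)
  have h3 := mul_le_mul_of_nonneg_left (diag_le_trace hP j) (frob_nonneg Y)
  rw [Real.norm_eq_abs]
  linarith

lemma tendsto_trace {f : ℕ → Matrix (Fin n) (Fin n) ℝ} {X : Matrix (Fin n) (Fin n) ℝ}
    (h : Tendsto f atTop (𝓝 X)) : Tendsto (fun t => (f t).trace) atTop (𝓝 X.trace) :=
  (((continuous_id (X := Matrix (Fin n) (Fin n) ℝ)).matrix_trace).tendsto X).comp h

lemma tendsto_entry {f : ℕ → Matrix (Fin n) (Fin n) ℝ} {X : Matrix (Fin n) (Fin n) ℝ}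
    (h : Tendsto f atTop (𝓝 X)) (i j : Fin n) :
    Tendsto (fun t => f t i j) atTop (𝓝 (X i j)) :=
  tendsto_pi_nhds.mp (tendsto_pi_nhds.mp h i) j

/-- The dual family is stable: its orbit of the identity has the same traces. -/
lemma Stable.dual (h : Stable C) : Stable (adjFamily C) := by
  refine stable_of_trace_one ?_
  have := tendsto_trace (h 1)
  rw [Matrix.trace_zero] at this
  refine this.congr fun t => ?_
  have := trace_mul_krausOp_pow (C := C) 1 1 t
  simpa using this

/-- For a stable family `1 - krausOp C` is injective, because a fixed point equals its images
under all powers; hence it is invertible. -/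
lemma Stable.isUnit (h : Stable C) : IsUnit (1 - krausOp C) := by
  rw [Module.End.isUnit_iff]
  have hinj : Function.Injective
      ⇑(1 - krausOp C : Module.End ℝ (Matrix (Fin n) (Fin n) ℝ)) := by
    rw [← LinearMap.ker_eq_bot, LinearMap.ker_eq_bot']
    intro X hX
    have hfix : krausOp C X = X := by
      rw [LinearMap.sub_apply, Module.End.one_apply, sub_eq_zero] at hX
      exact hX.symm
    have hpow : ∀ t : ℕ, (krausOp C ^ t) X = X := by
      intro t
      induction t with
      | zero => simp
      | succ t ih => rw [pow_succ, Module.End.mul_apply, hfix, ih]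
    exact tendsto_nhds_unique tendsto_const_nhds ((h X).congr hpow)
  exact ⟨hinj, LinearMap.surjective_of_injective hinj⟩

lemma Stable.lyap_sub (h : Stable C) (X : Matrix (Fin n) (Fin n) ℝ) :
    lyap C X - krausOp C (lyap C X) = X := by
  have := congrArg (fun T : Module.End ℝ (Matrix (Fin n) (Fin n) ℝ) => T X)
    (Ring.mul_inverse_cancel _ h.isUnit)
  simpa [lyap] using this

lemma Stable.krausOp_lyap (h : Stable C) (X : Matrix (Fin n) (Fin n) ℝ) :
    krausOp C (lyap C X) = lyap C X - X := by
  have := h.lyap_sub X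
  rw [sub_eq_iff_eq_add] at this
  rw [eq_sub_iff_add_eq, add_comm]; exact this.symm

lemma Stable.lyap_unique (h : Stable C) {X Z : Matrix (Fin n) (Fin n) ℝ}
    (hZ : Z - krausOp C Z = X) : Z = lyap C X := by
  have := congrArg (fun T : Module.End ℝ (Matrix (Fin n) (Fin n) ℝ) => T Z)
    (Ring.inverse_mul_cancel _ h.isUnit)
  rw [← hZ]
  simpa [lyap] using this.symm

lemma sum_krausOp_pow (X : Matrix (Fin n) (Fin n) ℝ) (N : ℕ) :
    ∑ t ∈ Finset.range N, (krausOp C ^ t) (X - krausOp C X) = X - (krausOp C ^ N) X := by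
  have : ∀ t, (krausOp C ^ t) (X - krausOp C X) = (krausOp C ^ t) X - (krausOp C ^ (t + 1)) X := by
    intro t
    rw [map_sub, pow_succ, Module.End.mul_apply]
  simp only [this]
  rw [Finset.sum_range_sub']
  simp

lemma Stable.tendsto_sum (h : Stable C) (X : Matrix (Fin n) (Fin n) ℝ) :
    Tendsto (fun N => ∑ t ∈ Finset.range N, (krausOp C ^ t) X) atTop (𝓝 (lyap C X)) := by
  have e : ∀ N, lyap C X - (krausOp C ^ N) (lyap C X) =
      ∑ t ∈ Finset.range N, (krausOp C ^ t) X := by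
    intro N
    rw [← sum_krausOp_pow, h.lyap_sub]
  have := (tendsto_const_nhds (x := lyap C X)).sub (h (lyap C X))
  rw [sub_zero] at this
  exact this.congr e

lemma tendsto_form {f : ℕ → Matrix (Fin n) (Fin n) ℝ} {X : Matrix (Fin n) (Fin n) ℝ}
    (h : Tendsto f atTop (𝓝 X)) (u v : Fin n → ℝ) :
    Tendsto (fun t => u ⬝ᵥ f t *ᵥ v) atTop (𝓝 (u ⬝ᵥ X *ᵥ v)) := by
  have hc : Continuous fun M : Matrix (Fin n) (Fin n) ℝ => u ⬝ᵥ M *ᵥ v := by fun_prop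
  exact (hc.tendsto X).comp h

lemma posSemidef_of_tendsto {f : ℕ → Matrix (Fin n) (Fin n) ℝ} {X : Matrix (Fin n) (Fin n) ℝ}
    (h : Tendsto f atTop (𝓝 X)) (hf : ∀ t, (f t).PosSemidef) : X.PosSemidef := by
  refine Matrix.PosSemidef.of_dotProduct_mulVec_nonneg ?_ fun v => ?_
  · ext i j
    refine tendsto_nhds_unique (tendsto_entry h j i) ?_
    refine (tendsto_entry h i j).congr fun t => ?_
    simpa using ((hf t).isHermitian.apply i j).symm
  · simpa using ge_of_tendsto' (tendsto_form h v v) fun t => form_nonneg (hf t) v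

lemma Stable.lyap_posSemidef (h : Stable C) {X : Matrix (Fin n) (Fin n) ℝ}
    (hX : X.PosSemidef) : (lyap C X).PosSemidef :=
  posSemidef_of_tendsto (h.tendsto_sum X) fun _ =>
    Matrix.posSemidef_sum _ fun _ _ => krausOp_pow_posSemidef hX _

lemma Stable.form_le_lyap (h : Stable C) {X : Matrix (Fin n) (Fin n) ℝ}
    (hX : X.PosSemidef) (v : Fin n → ℝ) : v ⬝ᵥ X *ᵥ v ≤ v ⬝ᵥ lyap C X *ᵥ v := by
  have h1 := form_nonneg (krausOp_posSemidef (C := C) (h.lyap_posSemidef hX)) v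
  rw [h.krausOp_lyap, Matrix.sub_mulVec, dotProduct_sub] at h1
  linarith

lemma Stable.trace_mul_lyap (h : Stable C) (Y X : Matrix (Fin n) (Fin n) ℝ) :
    (Y * lyap C X).trace = (lyap (adjFamily C) Y * X).trace := by
  have h1 := h.dual.lyap_sub Y
  have h2 := h.lyap_sub X
  have h3 := trace_mul_krausOp (C := C) (lyap (adjFamily C) Y) (lyap C X)
  calc (Y * lyap C X).trace
      = ((lyap (adjFamily C) Y - krausOp (adjFamily C) (lyap (adjFamily C) Y)) *
          lyap C X).trace := by rw [h1]
    _ = (lyap (adjFamily C) Y * (lyap C X - krausOp C (lyap C X))).trace := by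
        rw [Matrix.sub_mul, Matrix.mul_sub, Matrix.trace_sub, Matrix.trace_sub, h3]
    _ = _ := by rw [h2]

/-- Domination of bilinear forms passes to solutions of the Lyapunov equation. -/
lemma Stable.form_dominated_lyap (h : Stable C) {X Y : Matrix (Fin n) (Fin n) ℝ}
    (hd : ∀ u v, 2 * |u ⬝ᵥ Y *ᵥ v| ≤ u ⬝ᵥ X *ᵥ u + v ⬝ᵥ X *ᵥ v) (u v : Fin n → ℝ) :
    2 * |u ⬝ᵥ lyap C Y *ᵥ v| ≤ u ⬝ᵥ lyap C X *ᵥ u + v ⬝ᵥ lyap C X *ᵥ v := by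
  refine le_of_tendsto_of_tendsto' ((tendsto_form (h.tendsto_sum Y) u v).abs.const_mul 2)
    ((tendsto_form (h.tendsto_sum X) u u).add (tendsto_form (h.tendsto_sum X) v v)) fun N => ?_
  simp only [Matrix.sum_mulVec, dotProduct_sum]
  rw [← Finset.sum_add_distrib]
  calc _ ≤ 2 * ∑ t ∈ Finset.range N, |u ⬝ᵥ (krausOp C ^ t) Y *ᵥ v| := by
        gcongr; exact Finset.abs_sum_le_sum_abs _ _
    _ ≤ _ := by
        rw [Finset.mul_sum]
        exact Finset.sum_le_sum fun t _ => form_dominated_krausOp_pow hd t u v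

/-- Lyapunov's criterion: a positive semidefinite `Y` that decreases strictly under the adjoint
map certifies stability. -/
lemma stable_of_lyapunov {Y : Matrix (Fin n) (Fin n) ℝ} (hY : Y.PosSemidef) {c : ℝ} (hc : 0 < c)
    (h : ∀ v, v ⬝ᵥ krausOp (adjFamily C) Y *ᵥ v ≤ v ⬝ᵥ Y *ᵥ v - c * (v ⬝ᵥ v)) : Stable C := by
  refine stable_of_trace_one ?_
  have hP := fun t => krausOp_pow_posSemidef (C := C) (Matrix.PosSemidef.one (n := Fin n) (R := ℝ)) t
  have step : ∀ t, c * ((krausOp C ^ t) 1).trace ≤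
      (Y * (krausOp C ^ t) 1).trace - (Y * (krausOp C ^ (t + 1)) 1).trace := by
    intro t
    have h1 := trace_mul_mono_of_form (M := krausOp (adjFamily C) Y) (N := Y - c • 1)
      (fun v => by
        simpa [Matrix.sub_mulVec, Matrix.smul_mulVec, dotProduct_sub] using h v) (hP t)
    rw [Matrix.sub_mul, Matrix.trace_sub, Matrix.smul_mul, Matrix.one_mul, Matrix.trace_smul,
      smul_eq_mul, ← trace_mul_krausOp] at h1
    rw [pow_succ', Module.End.mul_apply]
    linarith
  have hnn : ∀ t, 0 ≤ ((krausOp C ^ t) 1).trace := fun t => (hP t).trace_nonneg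
  have hsum : Summable fun t => ((krausOp C ^ t) 1).trace := by
    refine summable_of_sum_range_le (c := c⁻¹ * (Y * 1).trace) hnn fun N => ?_
    have h1 : c * ∑ t ∈ Finset.range N, ((krausOp C ^ t) 1).trace ≤ (Y * 1).trace := by
      rw [Finset.mul_sum]
      refine (Finset.sum_le_sum fun t _ => step t).trans ?_
      rw [Finset.sum_range_sub']
      have := trace_mul_nonneg_of_form (form_nonneg hY) (hP N)
      simp only [pow_zero, Module.End.one_apply]
      linarith
    rw [inv_mul_eq_div, le_div_iff₀ hc]
    linarith
  exact hsum.tendsto_atTop_zero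

lemma Stable.trace_lyap_le (hC : Stable C) {Y : Matrix (Fin n) (Fin n) ℝ} {c : ℝ}
    (h : ∀ v, v ⬝ᵥ krausOp (adjFamily C) Y *ᵥ v ≤ v ⬝ᵥ Y *ᵥ v - c * (v ⬝ᵥ v))
    {X : Matrix (Fin n) (Fin n) ℝ} (hX : X.PosSemidef) :
    c * (lyap C X).trace ≤ (Y * X).trace := by
  have h1 := trace_mul_mono_of_form (M := krausOp (adjFamily C) Y) (N := Y - c • 1)
    (fun v => by
      simpa [Matrix.sub_mulVec, Matrix.smul_mulVec, dotProduct_sub] using h v)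
    (hC.lyap_posSemidef hX)
  rw [Matrix.sub_mul, Matrix.trace_sub, Matrix.smul_mul, Matrix.one_mul, Matrix.trace_smul,
    smul_eq_mul, ← trace_mul_krausOp, hC.krausOp_lyap, Matrix.mul_sub, Matrix.trace_sub] at h1
  linarith

end Kraus

/-! ### The deterministic second-moment problem -/

/-- Second-moment description of a linear quadratic regulator with multiplicative noise: under
the gain `K` the second moment evolves by `X ↦ ∑ₐ (Aₐ + Bₐ K) X (Aₐ + Bₐ K)ᵀ` from the initial
second moment `S`, and `Q`, `R` weigh state and input. -/
structure MomentLQR (ι : Type*) (n m : ℕ) where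
  A : ι → Matrix (Fin n) (Fin n) ℝ
  B : ι → Matrix (Fin n) (Fin m) ℝ
  Q : Matrix (Fin n) (Fin n) ℝ
  R : Matrix (Fin m) (Fin m) ℝ
  S : Matrix (Fin n) (Fin n) ℝ

namespace MomentLQR

variable {ι : Type*} {n m : ℕ}

/-- Closed-loop family `Aₐ + Bₐ K`. -/
def cl (L : MomentLQR ι n m) (K : Matrix (Fin m) (Fin n) ℝ) : ι → Matrix (Fin n) (Fin n) ℝ :=
  fun a => L.A a + L.B a * K

/-- Weight `Q + Kᵀ R K` of the stage cost under the gain `K`. -/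
def stageMat (L : MomentLQR ι n m) (K : Matrix (Fin m) (Fin n) ℝ) : Matrix (Fin n) (Fin n) ℝ :=
  L.Q + Kᵀ * L.R * K

/-- Aggregate second moment `Σ_K`. -/
def cov [Fintype ι] (L : MomentLQR ι n m) (K : Matrix (Fin m) (Fin n) ℝ) :
    Matrix (Fin n) (Fin n) ℝ :=
  lyap (L.cl K) L.S

/-- Value matrix `P_K`, the cost-to-go being `xᵀ P_K x`. -/
def val [Fintype ι] (L : MomentLQR ι n m) (K : Matrix (Fin m) (Fin n) ℝ) :
    Matrix (Fin n) (Fin n) ℝ :=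
  lyap (adjFamily (L.cl K)) (L.stageMat K)

/-- Total cost `tr((Q + Kᵀ R K) Σ_K)`. -/
def cost [Fintype ι] (L : MomentLQR ι n m) (K : Matrix (Fin m) (Fin n) ℝ) : ℝ :=
  (L.stageMat K * L.cov K).trace

/-- `R + ∑ₐ Bₐᵀ P_K Bₐ`, the second-order coefficient of the cost. -/
def hess [Fintype ι] (L : MomentLQR ι n m) (K : Matrix (Fin m) (Fin n) ℝ) :
    Matrix (Fin m) (Fin m) ℝ :=
  L.R + ∑ a, (L.B a)ᵀ * L.val K * L.B a

/-- `E_K = R K + ∑ₐ Bₐᵀ P_K (Aₐ + Bₐ K)`, so that the gradient of the cost is `2 E_K Σ_K`. -/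
def defect [Fintype ι] (L : MomentLQR ι n m) (K : Matrix (Fin m) (Fin n) ℝ) :
    Matrix (Fin m) (Fin n) ℝ :=
  L.R * K + ∑ a, (L.B a)ᵀ * L.val K * L.cl K a

/-- The policy gradient `2 E_K Σ_K`. -/
def grad [Fintype ι] (L : MomentLQR ι n m) (K : Matrix (Fin m) (Fin n) ℝ) :
    Matrix (Fin m) (Fin n) ℝ :=
  (2 : ℝ) • (L.defect K * L.cov K)

/-- The solution of `Y = ∑ₐ (Aₐ + Bₐ K)ᵀ Y (Aₐ + Bₐ K) + 1`. -/
def cert [Fintype ι] (L : MomentLQR ι n m) (K : Matrix (Fin m) (Fin n) ℝ) :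
    Matrix (Fin n) (Fin n) ℝ :=
  lyap (adjFamily (L.cl K)) 1

/-- `∑ₐ ‖Aₐ‖²`. -/
def sqA [Fintype ι] (L : MomentLQR ι n m) : ℝ := ∑ a, specNorm (L.A a) ^ 2

/-- `∑ₐ ‖Bₐ‖²`. -/
def sqB [Fintype ι] (L : MomentLQR ι n m) : ℝ := ∑ a, specNorm (L.B a) ^ 2

/-- The standing assumptions, with quantitative lower bounds `R ≥ sR > 0` and `S ≥ s₀ > 0`. -/
structure Regular (L : MomentLQR ι n m) (sR s₀ : ℝ) : Prop where
  Q_psd : L.Q.PosSemidef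
  R_psd : L.R.PosSemidef
  S_psd : L.S.PosSemidef
  sR_pos : 0 < sR
  s₀_pos : 0 < s₀
  R_ge : ∀ v, sR * (v ⬝ᵥ v) ≤ v ⬝ᵥ L.R *ᵥ v
  S_ge : ∀ v, s₀ * (v ⬝ᵥ v) ≤ v ⬝ᵥ L.S *ᵥ v

/-- `K` is stabilizing and of least cost among the stabilizing gains. -/
def IsOpt [Fintype ι] (L : MomentLQR ι n m) (K : Matrix (Fin m) (Fin n) ℝ) : Prop :=
  Stable (L.cl K) ∧ ∀ K', Stable (L.cl K') → L.cost K ≤ L.cost K'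

variable {L : MomentLQR ι n m} {sR s₀ : ℝ} {K K' Δ : Matrix (Fin m) (Fin n) ℝ}

lemma posSemidef_conj_transpose {X : Matrix (Fin m) (Fin m) ℝ} (hX : X.PosSemidef)
    (F : Matrix (Fin m) (Fin n) ℝ) : (Fᵀ * X * F).PosSemidef := by
  simpa using posSemidef_conj hX Fᵀ

lemma Regular.stageMat_psd (h : L.Regular sR s₀) : (L.stageMat K).PosSemidef :=
  h.Q_psd.add (posSemidef_conj_transpose h.R_psd K)

lemma Regular.trace_mul_S_ge (h : L.Regular sR s₀) {Y : Matrix (Fin n) (Fin n) ℝ}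
    (hY : Y.PosSemidef) : s₀ * Y.trace ≤ (Y * L.S).trace := by
  have := trace_mul_mono_of_form (M := s₀ • 1) (N := L.S) (fun v => by
    simpa [Matrix.smul_mulVec] using h.S_ge v) hY
  rw [Matrix.trace_mul_comm Y]
  simpa using this

lemma Regular.trace_R_ge (h : L.Regular sR s₀) {X : Matrix (Fin m) (Fin m) ℝ}
    (hX : X.PosSemidef) : sR * X.trace ≤ (L.R * X).trace := by
  have := trace_mul_mono_of_form (M := sR • 1) (N := L.R) (fun v => by
    simpa [Matrix.smul_mulVec] using h.R_ge v) hX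
  simpa using this

lemma en_cl_transpose_mulVec_le {κ : ℝ} (hκ : frob K ≤ κ) (a : ι) (v : Fin n → ℝ) :
    en ((L.cl K a)ᵀ *ᵥ v) ≤ (specNorm (L.A a) + specNorm (L.B a) * κ) * en v := by
  have e : (L.cl K a)ᵀ *ᵥ v = (L.A a)ᵀ *ᵥ v + Kᵀ *ᵥ ((L.B a)ᵀ *ᵥ v) := by
    simp [cl, Matrix.add_mulVec]
  rw [e]
  have h1 := en_transpose_mulVec_le_specNorm (L.A a) v
  have h2 := en_mulVec_le_frob Kᵀ ((L.B a)ᵀ *ᵥ v)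
  have h3 := en_transpose_mulVec_le_specNorm (L.B a) v
  rw [frob_transpose] at h2
  have h4 : frob K * en ((L.B a)ᵀ *ᵥ v) ≤ κ * (specNorm (L.B a) * en v) :=
    mul_le_mul hκ h3 (en_nonneg _) ((frob_nonneg _).trans hκ)
  have h5 := en_add_le ((L.A a)ᵀ *ᵥ v) (Kᵀ *ᵥ ((L.B a)ᵀ *ᵥ v))
  linarith

lemma stageMat_add (hR : L.Rᵀ = L.R) (K Δ : Matrix (Fin m) (Fin n) ℝ) :
    L.stageMat (K + Δ) = L.stageMat K + Δᵀ * (L.R * K) + (L.R * K)ᵀ * Δ + Δᵀ * L.R * Δ := by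
  simp only [stageMat, Matrix.transpose_add, Matrix.transpose_mul, hR, Matrix.mul_add,
    Matrix.add_mul, Matrix.mul_assoc]
  abel

variable [Fintype ι]

lemma sqA_nonneg : 0 ≤ L.sqA := Finset.sum_nonneg fun _ _ => sq_nonneg _

lemma sqB_nonneg : 0 ≤ L.sqB := Finset.sum_nonneg fun _ _ => sq_nonneg _

lemma Regular.cov_psd (h : L.Regular sR s₀) (hK : Stable (L.cl K)) : (L.cov K).PosSemidef :=
  hK.lyap_posSemidef h.S_psd

lemma Regular.val_psd (h : L.Regular sR s₀) (hK : Stable (L.cl K)) : (L.val K).PosSemidef :=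
  hK.dual.lyap_posSemidef h.stageMat_psd

lemma cert_psd (hK : Stable (L.cl K)) : (L.cert K).PosSemidef :=
  hK.dual.lyap_posSemidef Matrix.PosSemidef.one

lemma cost_eq_trace_val (hK : Stable (L.cl K)) : L.cost K = (L.val K * L.S).trace :=
  hK.trace_mul_lyap _ _

lemma trace_cert_mul_S (hK : Stable (L.cl K)) : (L.cert K * L.S).trace = (L.cov K).trace := by
  rw [cert, ← hK.trace_mul_lyap, Matrix.one_mul, cov]

/-! ### Expansion of the cost around a stabilizing gain -/

lemma transpose_eq_of_psd {X : Matrix (Fin n) (Fin n) ℝ} (hX : X.PosSemidef) : Xᵀ = X := by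
  simpa using hX.isHermitian.eq

lemma krausOp_dual_cl_add {V : Matrix (Fin n) (Fin n) ℝ} (hV : Vᵀ = V)
    (K Δ : Matrix (Fin m) (Fin n) ℝ) :
    krausOp (adjFamily (L.cl (K + Δ))) V = krausOp (adjFamily (L.cl K)) V +
      Δᵀ * (∑ a, (L.B a)ᵀ * V * L.cl K a) + (∑ a, (L.B a)ᵀ * V * L.cl K a)ᵀ * Δ +
      Δᵀ * (∑ a, (L.B a)ᵀ * V * L.B a) * Δ := by
  simp only [krausOp_apply, adjFamily, Matrix.transpose_transpose, Matrix.transpose_sum,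
    Matrix.mul_sum, Matrix.sum_mul, ← Finset.sum_add_distrib]
  refine Finset.sum_congr rfl fun a _ => ?_
  have e : L.cl (K + Δ) a = L.cl K a + L.B a * Δ := by
    simp [cl, Matrix.mul_add, add_assoc]
  rw [e]
  simp only [Matrix.transpose_add, Matrix.transpose_mul, Matrix.transpose_transpose, hV,
    Matrix.mul_add, Matrix.add_mul, Matrix.mul_assoc]
  abel

/-- Exact expansion of the cost: the remainder after the linear term is a quadratic form, but both
are weighted with the second moment `Σ_{K'}` of the new gain. -/
lemma Regular.cost_add (h : L.Regular sR s₀) (hK : Stable (L.cl K))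
    (hK' : Stable (L.cl (K + Δ))) :
    L.cost (K + Δ) - L.cost K = 2 * (L.defect K * L.cov (K + Δ) * Δᵀ).trace +
      (L.hess K * (Δ * L.cov (K + Δ) * Δᵀ)).trace := by
  have hV := transpose_eq_of_psd (h.val_psd hK)
  have hR : L.Rᵀ = L.R := by simpa using h.R_psd.isHermitian.eq
  set X := L.cov (K + Δ) with hX
  have hXs : Xᵀ = X := transpose_eq_of_psd (h.cov_psd hK')
  have hS : L.S = X - krausOp (L.cl (K + Δ)) X := (hK'.lyap_sub L.S).symm
  have e1 : L.cost K = (L.val K * X).trace -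
      (krausOp (adjFamily (L.cl (K + Δ))) (L.val K) * X).trace := by
    rw [cost_eq_trace_val hK, hS, Matrix.mul_sub, Matrix.trace_sub, trace_mul_krausOp]
  have e2 : krausOp (adjFamily (L.cl K)) (L.val K) = L.val K - L.stageMat K :=
    hK.dual.krausOp_lyap _
  have e3 : L.stageMat (K + Δ) + krausOp (adjFamily (L.cl (K + Δ))) (L.val K) =
      L.val K + Δᵀ * L.defect K + (L.defect K)ᵀ * Δ + Δᵀ * L.hess K * Δ := by
    rw [krausOp_dual_cl_add hV, stageMat_add hR, e2, defect, hess]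
    simp only [Matrix.transpose_add, Matrix.mul_add, Matrix.add_mul]
    abel
  have e4 : L.cost (K + Δ) - L.cost K =
      (Δᵀ * L.defect K * X).trace + ((L.defect K)ᵀ * Δ * X).trace +
        (Δᵀ * L.hess K * Δ * X).trace := by
    have := congrArg (fun M => (M * X).trace) e3
    simp only [Matrix.add_mul, Matrix.trace_add] at this
    rw [e1, cost, ← hX]
    linarith
  have e5 : ((L.defect K)ᵀ * Δ * X).trace = (Δᵀ * L.defect K * X).trace := by
    rw [← Matrix.trace_transpose]
    simp only [Matrix.transpose_mul, Matrix.transpose_transpose, hXs]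
    rw [Matrix.trace_mul_comm]
  have e6 : (Δᵀ * L.defect K * X).trace = (L.defect K * X * Δᵀ).trace := by
    rw [Matrix.mul_assoc, Matrix.trace_mul_comm]
  have e7 : (Δᵀ * L.hess K * Δ * X).trace = (L.hess K * (Δ * X * Δᵀ)).trace := by
    rw [Matrix.mul_assoc, Matrix.mul_assoc, Matrix.trace_mul_comm, Matrix.mul_assoc]
  rw [e4, e5, e6, e7]; ring

/-! ### A priori bounds -/

lemma Regular.cost_nonneg (h : L.Regular sR s₀) (hK : Stable (L.cl K)) : 0 ≤ L.cost K :=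
  trace_mul_nonneg_of_form (form_nonneg h.stageMat_psd) (h.cov_psd hK)

lemma Regular.trace_val_le (h : L.Regular sR s₀) (hK : Stable (L.cl K)) :
    s₀ * (L.val K).trace ≤ L.cost K := by
  rw [cost_eq_trace_val hK]
  exact h.trace_mul_S_ge (h.val_psd hK)

lemma Regular.trace_cert_le (h : L.Regular sR s₀) (hK : Stable (L.cl K)) :
    s₀ * (L.cert K).trace ≤ (L.cov K).trace := by
  rw [← trace_cert_mul_S hK]
  exact h.trace_mul_S_ge (cert_psd hK)

lemma Regular.cov_ge (h : L.Regular sR s₀) (hK : Stable (L.cl K)) (v : Fin n → ℝ) :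
    s₀ * (v ⬝ᵥ v) ≤ v ⬝ᵥ L.cov K *ᵥ v :=
  (h.S_ge v).trans (hK.form_le_lyap h.S_psd v)

lemma trace_mul_cov_mul_le {X : Matrix (Fin n) (Fin n) ℝ} (hX : X.PosSemidef)
    (F : Matrix (Fin m) (Fin n) ℝ) : (F * X * Fᵀ).trace ≤ X.trace * frob F ^ 2 := by
  have := trace_mul_mono_of_form (M := X) (N := X.trace • 1) (X := Fᵀ * F) (fun v => by
    simpa [Matrix.smul_mulVec] using form_le_trace hX v) (posSemidef_transpose_mul_self F)
  rw [Matrix.trace_mul_comm (F * X), ← Matrix.mul_assoc, Matrix.trace_mul_comm (Fᵀ * F)]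
  simpa [frob_sq_eq_trace] using this

/-- The input part of the cost alone bounds the gain. -/
lemma Regular.frob_gain_le (h : L.Regular sR s₀) (hK : Stable (L.cl K)) :
    sR * s₀ * frob K ^ 2 ≤ L.cost K := by
  have h1 := frob_sq_le_trace_of_form (h.cov_ge hK) K
  have h2 := h.trace_R_ge (posSemidef_conj (h.cov_psd hK) K)
  have h3 : 0 ≤ (L.Q * L.cov K).trace :=
    trace_mul_nonneg_of_form (form_nonneg h.Q_psd) (h.cov_psd hK)
  have h4 : L.cost K = (L.Q * L.cov K).trace + (L.R * (K * L.cov K * Kᵀ)).trace := by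
    rw [cost, stageMat, Matrix.add_mul, Matrix.trace_add]
    congr 1
    rw [Matrix.mul_assoc, Matrix.mul_assoc, Matrix.trace_mul_comm, Matrix.mul_assoc]
  have h5 := mul_le_mul_of_nonneg_left h1 h.sR_pos.le
  rw [h4]
  linarith

lemma Regular.hess_ge (h : L.Regular sR s₀) (hK : Stable (L.cl K)) (v : Fin m → ℝ) :
    sR * (v ⬝ᵥ v) ≤ v ⬝ᵥ L.hess K *ᵥ v := by
  have h1 : 0 ≤ v ⬝ᵥ (∑ a, (L.B a)ᵀ * L.val K * L.B a) *ᵥ v := by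
    refine form_nonneg (Matrix.posSemidef_sum _ fun a _ => ?_) v
    simpa using posSemidef_conj (h.val_psd hK) (L.B a)ᵀ
  rw [hess, Matrix.add_mulVec, dotProduct_add]
  linarith [h.R_ge v]

lemma dotProduct_self_mulVec_le {k l : ℕ} (M : Matrix (Fin k) (Fin l) ℝ) (v : Fin l → ℝ) :
    (M *ᵥ v) ⬝ᵥ (M *ᵥ v) ≤ specNorm M ^ 2 * (v ⬝ᵥ v) := by
  rw [← en_sq, ← en_sq, ← mul_pow]
  exact pow_le_pow_left₀ (en_nonneg _) (en_mulVec_le_specNorm M v) 2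

lemma Regular.hess_le (h : L.Regular sR s₀) (hK : Stable (L.cl K)) {w : ℝ}
    (hw : (L.val K).trace ≤ w) (v : Fin m → ℝ) :
    v ⬝ᵥ L.hess K *ᵥ v ≤ (specNorm L.R + L.sqB * w) * (v ⬝ᵥ v) := by
  have h1 : v ⬝ᵥ (∑ a, (L.B a)ᵀ * L.val K * L.B a) *ᵥ v ≤ L.sqB * w * (v ⬝ᵥ v) := by
    rw [Matrix.sum_mulVec, dotProduct_sum, sqB, Finset.sum_mul, Finset.sum_mul]
    refine Finset.sum_le_sum fun a _ => ?_
    have e : v ⬝ᵥ ((L.B a)ᵀ * L.val K * L.B a) *ᵥ v =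
        (L.B a *ᵥ v) ⬝ᵥ L.val K *ᵥ (L.B a *ᵥ v) := by
      rw [← Matrix.mulVec_mulVec, ← Matrix.mulVec_mulVec, Matrix.dotProduct_mulVec,
        Matrix.vecMul_transpose]
    rw [e]
    have h2 := form_le_trace (h.val_psd hK) (L.B a *ᵥ v)
    have h3 := dotProduct_self_mulVec_le (L.B a) v
    have h4 : 0 ≤ (L.val K).trace := (h.val_psd hK).trace_nonneg
    calc _ ≤ _ := h2
      _ ≤ w * (specNorm (L.B a) ^ 2 * (v ⬝ᵥ v)) :=
          mul_le_mul hw h3 (by rw [← en_sq]; positivity) (h4.trans hw)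
      _ = _ := by ring
  rw [hess, Matrix.add_mulVec, dotProduct_add, add_mul]
  linarith [form_le_specNorm L.R v]

lemma Regular.frob_defect_le (h : L.Regular sR s₀) (hK : Stable (L.cl K)) {w κ : ℝ}
    (hw : (L.val K).trace ≤ w) (hκ : frob K ≤ κ) :
    frob (L.defect K) ≤ specNorm L.R * κ + w * (L.sqA + L.sqB * (1 + κ)) := by
  have hκ0 : 0 ≤ κ := (frob_nonneg _).trans hκ
  have hw0 : 0 ≤ w := (h.val_psd hK).trace_nonneg.trans hw
  have h1 : frob (L.R * K) ≤ specNorm L.R * κ :=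
    (frob_mul_le_of_bound (specNorm_nonneg _) (en_mulVec_le_specNorm L.R) K).trans
      (mul_le_mul_of_nonneg_left hκ (specNorm_nonneg _))
  have h2 : ∀ a, frob ((L.B a)ᵀ * L.val K * L.cl K a) ≤
      w * (specNorm (L.A a) ^ 2 + specNorm (L.B a) ^ 2 * (1 + κ)) := by
    intro a
    have hA := specNorm_nonneg (L.A a)
    have hB := specNorm_nonneg (L.B a)
    have h3 : frob (L.val K * L.cl K a) ≤ (specNorm (L.A a) + specNorm (L.B a) * κ) * w := by
      rw [← frob_transpose, Matrix.transpose_mul]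
      refine (frob_mul_le_of_bound (by positivity) (en_cl_transpose_mulVec_le hκ a) _).trans ?_
      rw [frob_transpose]
      exact mul_le_mul_of_nonneg_left ((frob_le_trace (h.val_psd hK)).trans hw) (by positivity)
    rw [Matrix.mul_assoc]
    refine (frob_mul_le_of_bound hB (en_transpose_mulVec_le_specNorm (L.B a)) _).trans ?_
    refine (mul_le_mul_of_nonneg_left h3 hB).trans ?_
    nlinarith [mul_nonneg hw0 (sq_nonneg (specNorm (L.A a) - specNorm (L.B a))),
      mul_nonneg hw0 (sq_nonneg (specNorm (L.A a))), mul_nonneg hw0 (sq_nonneg (specNorm (L.B a)))]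
  have h3 : frob (∑ a, (L.B a)ᵀ * L.val K * L.cl K a) ≤ w * (L.sqA + L.sqB * (1 + κ)) := by
    refine (frob_sum_le _ _).trans ((Finset.sum_le_sum fun a _ => h2 a).trans (le_of_eq ?_))
    rw [← Finset.mul_sum, Finset.sum_add_distrib, ← Finset.sum_mul, sqA, sqB]
  exact (frob_add_le _ _).trans (add_le_add h1 h3)

/-! ### Perturbation of the gain -/

/-- The certificate of `K` still decreases under a perturbed gain, up to an error governed by the
perturbation; Young's inequality is used with weight `1 / (4 y)`. -/
lemma cert_form_le (hK : Stable (L.cl K)) {y : ℝ} (hy : 0 < y) (hY : (L.cert K).trace ≤ y)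
    (v : Fin n → ℝ) :
    v ⬝ᵥ krausOp (adjFamily (L.cl (K + Δ))) (L.cert K) *ᵥ v ≤
      v ⬝ᵥ L.cert K *ᵥ v - 3 / 4 * (v ⬝ᵥ v) +
        (1 + 4 * y) * y * L.sqB * ((Δ *ᵥ v) ⬝ᵥ (Δ *ᵥ v)) := by
  have hP := cert_psd hK
  set Y := L.cert K with hYdef
  have h1 : v ⬝ᵥ krausOp (adjFamily (L.cl K)) Y *ᵥ v = v ⬝ᵥ Y *ᵥ v - v ⬝ᵥ v := by
    rw [hYdef, cert, hK.dual.krausOp_lyap, Matrix.sub_mulVec, dotProduct_sub, Matrix.one_mulVec]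
  have hvv : 0 ≤ v ⬝ᵥ v := by rw [← en_sq]; positivity
  have hdd : 0 ≤ (Δ *ᵥ v) ⬝ᵥ (Δ *ᵥ v) := by rw [← en_sq]; positivity
  have h2 : ∀ a, (L.cl (K + Δ) a *ᵥ v) ⬝ᵥ Y *ᵥ (L.cl (K + Δ) a *ᵥ v) ≤
      (1 + 1 / (4 * y)) * ((L.cl K a *ᵥ v) ⬝ᵥ Y *ᵥ (L.cl K a *ᵥ v)) +
        (1 + 4 * y) * (y * (specNorm (L.B a) ^ 2 * ((Δ *ᵥ v) ⬝ᵥ (Δ *ᵥ v)))) := by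
    intro a
    have e : L.cl (K + Δ) a *ᵥ v = L.cl K a *ᵥ v + L.B a *ᵥ (Δ *ᵥ v) := by
      simp [cl, Matrix.mul_add, Matrix.add_mulVec, add_assoc]
    rw [e]
    refine (form_add_le hP (ε := 1 / (4 * y)) (κ := 4 * y) (by positivity)
      (by field_simp) _ _).trans ?_
    have h3 := form_le_trace hP (L.B a *ᵥ (Δ *ᵥ v))
    have h4 := dotProduct_self_mulVec_le (L.B a) (Δ *ᵥ v)
    have h5 : (L.B a *ᵥ (Δ *ᵥ v)) ⬝ᵥ Y *ᵥ (L.B a *ᵥ (Δ *ᵥ v)) ≤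
        y * (specNorm (L.B a) ^ 2 * ((Δ *ᵥ v) ⬝ᵥ (Δ *ᵥ v))) :=
      h3.trans (mul_le_mul hY h4 (by rw [← en_sq]; positivity) hy.le)
    have := mul_le_mul_of_nonneg_left h5 (show 0 ≤ 1 + 4 * y by linarith)
    linarith
  rw [krausOp_dual_form] at h1 ⊢
  refine (Finset.sum_le_sum fun a _ => h2 a).trans ?_
  rw [Finset.sum_add_distrib, ← Finset.mul_sum, h1, ← Finset.mul_sum, ← Finset.mul_sum,
    ← Finset.sum_mul]
  have h6 : 1 / (4 * y) * (v ⬝ᵥ Y *ᵥ v) ≤ 1 / 4 * (v ⬝ᵥ v) := by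
    have h7 : v ⬝ᵥ Y *ᵥ v ≤ y * (v ⬝ᵥ v) :=
      (form_le_trace hP v).trans (mul_le_mul_of_nonneg_right hY hvv)
    calc 1 / (4 * y) * (v ⬝ᵥ Y *ᵥ v) ≤ 1 / (4 * y) * (y * (v ⬝ᵥ v)) :=
          mul_le_mul_of_nonneg_left h7 (by positivity)
      _ = _ := by field_simp
  have h8 : 0 ≤ 1 / (4 * y) * (v ⬝ᵥ v) := by positivity
  rw [sqB]
  nlinarith

lemma cert_form_le_half (hK : Stable (L.cl K)) {y : ℝ} (hy : 0 < y) (hY : (L.cert K).trace ≤ y)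
    (hΔ : 4 * (1 + 4 * y) * y * L.sqB * frob Δ ^ 2 ≤ 1) (v : Fin n → ℝ) :
    v ⬝ᵥ krausOp (adjFamily (L.cl (K + Δ))) (L.cert K) *ᵥ v ≤
      v ⬝ᵥ L.cert K *ᵥ v - 1 / 2 * (v ⬝ᵥ v) := by
  have h1 := cert_form_le (Δ := Δ) hK hy hY v
  have h2 : (Δ *ᵥ v) ⬝ᵥ (Δ *ᵥ v) ≤ frob Δ ^ 2 * (v ⬝ᵥ v) := by
    rw [← en_sq, ← en_sq, ← mul_pow]
    exact pow_le_pow_left₀ (en_nonneg _) (en_mulVec_le_frob Δ v) 2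
  have hvv : 0 ≤ v ⬝ᵥ v := by rw [← en_sq]; positivity
  have hb := L.sqB_nonneg
  have h3 := mul_le_mul_of_nonneg_left h2 (show 0 ≤ (1 + 4 * y) * y * L.sqB by positivity)
  have h4 := mul_le_mul_of_nonneg_right hΔ hvv
  linarith

/-- The radius of stability of a gain depends only on a bound for the trace of its certificate. -/
lemma stable_add (hK : Stable (L.cl K)) {y : ℝ} (hy : 0 < y) (hY : (L.cert K).trace ≤ y)
    (hΔ : 4 * (1 + 4 * y) * y * L.sqB * frob Δ ^ 2 ≤ 1) : Stable (L.cl (K + Δ)) :=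
  stable_of_lyapunov (cert_psd hK) one_half_pos (cert_form_le_half hK hy hY hΔ)

lemma trace_lyap_add_le (hK : Stable (L.cl K)) {y : ℝ} (hy : 0 < y) (hY : (L.cert K).trace ≤ y)
    (hΔ : 4 * (1 + 4 * y) * y * L.sqB * frob Δ ^ 2 ≤ 1) {X : Matrix (Fin n) (Fin n) ℝ}
    (hX : X.PosSemidef) : (lyap (L.cl (K + Δ)) X).trace ≤ 2 * (L.cert K * X).trace := by
  have := (stable_add hK hy hY hΔ).trace_lyap_le (cert_form_le_half hK hy hY hΔ) hX
  linarith

/-- By homogeneity a bound by squared norms becomes one by the product of the norms, on rescaling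
`u` and `v` to equal length. -/
lemma abs_form_le_of_dominated {D : Matrix (Fin n) (Fin n) ℝ} {x : ℝ}
    (h : ∀ u v, 2 * |u ⬝ᵥ D *ᵥ v| ≤ x * (u ⬝ᵥ u + v ⬝ᵥ v)) (u v : Fin n → ℝ) :
    |u ⬝ᵥ D *ᵥ v| ≤ x * en u * en v := by
  have h1 := h (en v • u) (en u • v)
  simp only [Matrix.mulVec_smul, dotProduct_smul, smul_dotProduct, smul_eq_mul, ← en_sq,
    abs_mul, abs_of_nonneg (en_nonneg _)] at h1
  have zero : ∀ w : Fin n → ℝ, en w = 0 → w = 0 := fun w hw => by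
    simpa [en] using hw
  rcases (en_nonneg u).eq_or_lt with hu | hu
  · rw [zero u hu.symm]; simp [en]
  rcases (en_nonneg v).eq_or_lt with hv | hv
  · rw [zero v hv.symm]; simp [en]
  refine le_of_mul_le_mul_left (a := 2 * (en u * en v)) ?_ (by positivity)
  linarith

/-- Lipschitz dependence of the aggregate second moment on the gain: the right-hand side of the
Lyapunov equation for the difference is dominated by a multiple of the identity, and the solution
with right-hand side `1` has trace at most `2 y`. -/
lemma Regular.cov_add_sub_form (h : L.Regular sR s₀) (hK : Stable (L.cl K)) {y s κ : ℝ}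
    (hy : 0 < y) (hY : (L.cert K).trace ≤ y) (hs : (L.cov K).trace ≤ s) (hκ : frob K ≤ κ)
    (hΔ1 : frob Δ ≤ 1) (hΔ : 4 * (1 + 4 * y) * y * L.sqB * frob Δ ^ 2 ≤ 1) (u v : Fin n → ℝ) :
    |u ⬝ᵥ (L.cov (K + Δ) - L.cov K) *ᵥ v| ≤
      2 * y * (s * (L.sqA + L.sqB * (2 + 2 * κ)) * frob Δ) * en u * en v := by
  have hK' := stable_add hK hy hY hΔ
  set d := frob Δ with hd
  have hd0 : 0 ≤ d := frob_nonneg _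
  have hκ0 : 0 ≤ κ := (frob_nonneg _).trans hκ
  have hX := h.cov_psd hK
  have hs0 : 0 ≤ s := hX.trace_nonneg.trans hs
  set X := L.cov K with hXdef
  set G := krausOp (L.cl (K + Δ)) X - krausOp (L.cl K) X with hG
  set g := s * (L.sqA + L.sqB * (2 + 2 * κ)) * d with hg
  have hg0 : 0 ≤ g := by
    have := L.sqA_nonneg; have := L.sqB_nonneg; positivity
  -- The difference of the two solutions solves the Lyapunov equation of the new gain, with the
  -- difference of the two completely positive maps at `Σ_K` as right-hand side.
  have hD : L.cov (K + Δ) - X = lyap (L.cl (K + Δ)) G := by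
    refine hK'.lyap_unique ?_
    rw [map_sub, hG, cov, hK'.krausOp_lyap, hXdef, cov, hK.krausOp_lyap]
    abel
  have hGform : ∀ u v, |u ⬝ᵥ G *ᵥ v| ≤ g * en u * en v := by
    intro u v
    have hu0 := en_nonneg u
    have hv0 := en_nonneg v
    have term : ∀ a, |((L.cl (K + Δ) a)ᵀ *ᵥ u) ⬝ᵥ X *ᵥ ((L.cl (K + Δ) a)ᵀ *ᵥ v) -
        ((L.cl K a)ᵀ *ᵥ u) ⬝ᵥ X *ᵥ ((L.cl K a)ᵀ *ᵥ v)| ≤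
        s * (specNorm (L.A a) ^ 2 + specNorm (L.B a) ^ 2 * (2 + 2 * κ)) * d * (en u * en v) := by
      intro a
      have e : ∀ w, (L.cl (K + Δ) a)ᵀ *ᵥ w = (L.cl K a)ᵀ *ᵥ w + Δᵀ *ᵥ ((L.B a)ᵀ *ᵥ w) := by
        intro w
        simp [cl, Matrix.mul_add, Matrix.add_mulVec, add_assoc]
      rw [e, e]
      have hA := specNorm_nonneg (L.A a)
      have hB := specNorm_nonneg (L.B a)
      set α := specNorm (L.A a)
      set β := specNorm (L.B a)
      have hp : ∀ w, en ((L.cl K a)ᵀ *ᵥ w) ≤ (α + β * κ) * en w := en_cl_transpose_mulVec_le hκ a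
      have hp' : ∀ w, en (Δᵀ *ᵥ ((L.B a)ᵀ *ᵥ w)) ≤ d * β * en w := by
        intro w
        have h2 := en_mulVec_le_frob Δᵀ ((L.B a)ᵀ *ᵥ w)
        rw [frob_transpose, ← hd] at h2
        have h3 := mul_le_mul_of_nonneg_left (en_transpose_mulVec_le_specNorm (L.B a) w) hd0
        linarith
      have bil : ∀ (p q : Fin n → ℝ) (x z : ℝ), en p ≤ x → en q ≤ z →
          |p ⬝ᵥ X *ᵥ q| ≤ s * (x * z) := by
        intro p q x z hpx hqz
        have hx : 0 ≤ x := (en_nonneg p).trans hpx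
        refine (abs_form_le_trace hX p q).trans ?_
        rw [mul_assoc]
        exact mul_le_mul hs (mul_le_mul hpx hqz (en_nonneg _) hx)
          (mul_nonneg (en_nonneg _) (en_nonneg _)) hs0
      have b1 := bil _ _ _ _ (hp' u) (hp v)
      have b2 := bil _ _ _ _ (hp u) (hp' v)
      have b3 := bil _ _ _ _ (hp' u) (hp' v)
      generalize (L.cl K a)ᵀ *ᵥ u = p at *
      generalize (L.cl K a)ᵀ *ᵥ v = q at *
      generalize Δᵀ *ᵥ ((L.B a)ᵀ *ᵥ u) = p' at *
      generalize Δᵀ *ᵥ ((L.B a)ᵀ *ᵥ v) = q' at *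
      have e2 : (p + p') ⬝ᵥ X *ᵥ (q + q') - p ⬝ᵥ X *ᵥ q =
          p' ⬝ᵥ X *ᵥ q + p ⬝ᵥ X *ᵥ q' + p' ⬝ᵥ X *ᵥ q' := by
        simp only [Matrix.mulVec_add, dotProduct_add, add_dotProduct]; ring
      rw [e2]
      refine (abs_add_three _ _ _).trans ?_
      have huv : 0 ≤ s * d * (en u * en v) := by positivity
      have hpoly : 2 * (β * (α + β * κ)) + d * β ^ 2 ≤ α ^ 2 + β ^ 2 * (2 + 2 * κ) := by
        have : d * β ^ 2 ≤ 1 * β ^ 2 := mul_le_mul_of_nonneg_right hΔ1 (sq_nonneg _)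
        nlinarith [sq_nonneg (α - β)]
      have := mul_le_mul_of_nonneg_left hpoly huv
      linarith
    rw [hG, Matrix.sub_mulVec, dotProduct_sub, krausOp_form, krausOp_form, ← Finset.sum_sub_distrib]
    refine (Finset.abs_sum_le_sum_abs _ _).trans ((Finset.sum_le_sum fun a _ => term a).trans ?_)
    rw [← Finset.sum_mul, ← Finset.sum_mul, ← Finset.mul_sum, Finset.sum_add_distrib,
      ← Finset.sum_mul, hg, sqA, sqB]
    exact le_of_eq (by ring)
  have hT : (lyap (L.cl (K + Δ)) (1 : Matrix (Fin n) (Fin n) ℝ)).trace ≤ 2 * y := by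
    have := trace_lyap_add_le hK hy hY hΔ (Matrix.PosSemidef.one (n := Fin n) (R := ℝ))
    rw [Matrix.mul_one] at this
    linarith
  rw [hD]
  refine abs_form_le_of_dominated (fun u v => ?_) u v
  have hdom := hK'.form_dominated_lyap (X := g • 1) (Y := G) (fun u v => by
    simp only [Matrix.smul_mulVec, Matrix.one_mulVec, dotProduct_smul, smul_eq_mul, ← en_sq]
    nlinarith [hGform u v, mul_nonneg hg0 (sq_nonneg (en u - en v))]) u v
  refine hdom.trans ?_
  have hone := hK'.lyap_posSemidef (Matrix.PosSemidef.one (n := Fin n) (R := ℝ))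
  have fb : ∀ w : Fin n → ℝ, w ⬝ᵥ lyap (L.cl (K + Δ)) (g • 1) *ᵥ w ≤ 2 * y * g * (w ⬝ᵥ w) := by
    intro w
    rw [map_smul, Matrix.smul_mulVec, dotProduct_smul, smul_eq_mul]
    have h1 := form_le_trace hone w
    have hww : 0 ≤ w ⬝ᵥ w := by rw [← en_sq]; positivity
    have h2 := mul_le_mul_of_nonneg_right hT hww
    nlinarith [mul_le_mul_of_nonneg_left (h1.trans h2) hg0]
  linarith [fb u, fb v]

/-! ### Descent along the gradient -/

/-- Reciprocal of a step size that is admissible for one gradient step, in terms of `a = ∑ ‖Aₐ‖²`,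
`b = ∑ ‖Bₐ‖²`, `r = ‖R‖`, `z = 1 / s₀` and upper bounds `w`, `κ`, `s`, `y`, `e` for `tr P_K`,
`‖K‖_F`, `tr Σ_K`, the trace of the certificate, and `‖E_K‖_F`. Since `‖∇J‖_F ≤ 2 s e`, the
summands ensure in turn that the step has length at most `1`, that it stays within the radius of
stability, that it changes `Σ_K` by at most `s₀ / 4`, and that the quadratic term of the expansion
is small. -/
def stepBound {𝕜 : Type*} [CommSemiring 𝕜] (a b r z w κ s y e : 𝕜) : 𝕜 :=
  1 + 2 * s * e + 4 * (1 + 4 * y) * y * b * (2 * s * e) +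
    8 * y * (s * (a + b * (2 + 2 * κ))) * (2 * s * e) * z + 8 * ((r + b * w) * s)

lemma trace_mul_symm {X : Matrix (Fin n) (Fin n) ℝ} (hX : Xᵀ = X)
    (E F : Matrix (Fin m) (Fin n) ℝ) :
    (E * X * Fᵀ).trace = (F * X * Eᵀ).trace := by
  rw [← Matrix.trace_transpose]
  simp only [Matrix.transpose_mul, Matrix.transpose_transpose, hX, Matrix.mul_assoc]

lemma Regular.trace_hess_le (h : L.Regular sR s₀) (hK : Stable (L.cl K)) {w s : ℝ}
    (hw : (L.val K).trace ≤ w) {X : Matrix (Fin n) (Fin n) ℝ} (hX : X.PosSemidef)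
    (hs : X.trace ≤ s) :
    (L.hess K * (Δ * X * Δᵀ)).trace ≤ (specNorm L.R + L.sqB * w) * (s * frob Δ ^ 2) := by
  have hXc := posSemidef_conj hX Δ
  have h1 := trace_mul_mono_of_form (M := L.hess K) (N := (specNorm L.R + L.sqB * w) • 1)
    (fun v => by simpa [Matrix.smul_mulVec] using h.hess_le hK hw v) hXc
  rw [Matrix.smul_mul, Matrix.one_mul, Matrix.trace_smul, smul_eq_mul] at h1
  refine h1.trans (mul_le_mul_of_nonneg_left ?_ ?_)
  · exact (trace_mul_cov_mul_le hX Δ).trans (mul_le_mul_of_nonneg_right hs (sq_nonneg _))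
  · have := specNorm_nonneg L.R
    have := L.sqB_nonneg
    have := (h.val_psd hK).trace_nonneg.trans hw
    positivity

lemma Regular.trace_hess_ge (h : L.Regular sR s₀) (hK : Stable (L.cl K))
    {X : Matrix (Fin n) (Fin n) ℝ} (hX : X.PosSemidef) :
    sR * (Δ * X * Δᵀ).trace ≤ (L.hess K * (Δ * X * Δᵀ)).trace := by
  have h1 := trace_mul_mono_of_form (M := sR • 1) (N := L.hess K)
    (fun v => by simpa [Matrix.smul_mulVec] using h.hess_ge hK v) (posSemidef_conj hX Δ)
  simpa using h1

lemma Regular.trace_hess_nonneg (h : L.Regular sR s₀) (hK : Stable (L.cl K))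
    {X : Matrix (Fin n) (Fin n) ℝ} (hX : X.PosSemidef) :
    0 ≤ (L.hess K * (Δ * X * Δᵀ)).trace :=
  (mul_nonneg h.sR_pos.le (posSemidef_conj hX Δ).trace_nonneg).trans (h.trace_hess_ge hK hX)

lemma Regular.frob_defect_le_grad (h : L.Regular sR s₀) (hK : Stable (L.cl K)) :
    2 * (s₀ * frob (L.defect K)) ≤ frob (L.grad K) := by
  rw [grad, frob_smul, abs_two]
  gcongr
  exact frob_le_frob_mul_of_form (h.cov_psd hK) (h.cov_ge hK) _

lemma Regular.frob_grad_le (h : L.Regular sR s₀) (hK : Stable (L.cl K)) {s e : ℝ}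
    (hs : (L.cov K).trace ≤ s) (he : frob (L.defect K) ≤ e) : frob (L.grad K) ≤ 2 * s * e := by
  rw [grad, frob_smul, abs_two]
  have h1 := frob_mul_le (L.defect K) (L.cov K)
  have h2 : frob (L.defect K) * frob (L.cov K) ≤ e * s :=
    mul_le_mul he ((frob_le_trace (h.cov_psd hK)).trans hs) (frob_nonneg _)
      ((frob_nonneg _).trans he)
  linarith

/-- The individual smallness conditions on the step size contained in `stepBound`. -/
lemma step_conditions {a b r w κ s y e η N : ℝ} (ha : 0 ≤ a) (hb : 0 ≤ b) (hr : 0 ≤ r)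
    (hs₀ : 0 < s₀) (hw : 0 ≤ w) (hκ : 0 ≤ κ) (hs : 0 ≤ s) (hy : 0 < y) (he : 0 ≤ e) (hη : 0 ≤ η)
    (hN : N = 2 * s * e) (hηb : η * stepBound a b r s₀⁻¹ w κ s y e ≤ 1) :
    η * N ≤ 1 ∧ 4 * (1 + 4 * y) * y * b * (η * N) ≤ 1 ∧
      8 * y * (s * (a + b * (2 + 2 * κ))) * (η * N) ≤ s₀ ∧
      η * (8 * ((r + b * w) * s)) ≤ 1 := by
  have hz : 0 < s₀⁻¹ := inv_pos.mpr hs₀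
  have hN0 : 0 ≤ N := by rw [hN]; positivity
  have p1 : 0 ≤ η * N := by positivity
  have p2 : 0 ≤ η * (4 * (1 + 4 * y) * y * b * N) := by positivity
  have p3 : 0 ≤ η * (8 * y * (s * (a + b * (2 + 2 * κ))) * N * s₀⁻¹) := by positivity
  have p4 : 0 ≤ η * (8 * ((r + b * w) * s)) := by positivity
  have hsum : η + η * N + η * (4 * (1 + 4 * y) * y * b * N) +
      η * (8 * y * (s * (a + b * (2 + 2 * κ))) * N * s₀⁻¹) + η * (8 * ((r + b * w) * s)) ≤ 1 := by
    refine le_trans (le_of_eq ?_) hηb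
    rw [stepBound, hN]; ring
  refine ⟨by linarith, by linarith, ?_, by linarith⟩
  have : (8 * y * (s * (a + b * (2 + 2 * κ))) * (η * N)) * s₀⁻¹ ≤ 1 := by linarith
  rwa [← div_eq_mul_inv, div_le_one hs₀] at this

/-- One gradient step of admissible size stays stabilizing and decreases the cost by at least
`η / 2` times the squared norm of the gradient. In the exact expansion of the cost, the new second
moment differs from the old one by at most `s₀ / 4`, so the linear term contributes at most
`- 3/4 η ‖∇‖²`; the quadratic term contributes at most `1/4 η ‖∇‖²`. -/
lemma Regular.descent (h : L.Regular sR s₀) (hK : Stable (L.cl K)) {w κ s y e η : ℝ}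
    (hw : (L.val K).trace ≤ w) (hκ : frob K ≤ κ) (hs : (L.cov K).trace ≤ s) (hy : 0 < y)
    (hY : (L.cert K).trace ≤ y) (he : frob (L.defect K) ≤ e) (hη : 0 ≤ η)
    (hηb : η * stepBound L.sqA L.sqB (specNorm L.R) s₀⁻¹ w κ s y e ≤ 1) :
    Stable (L.cl (K + (-η) • L.grad K)) ∧
      L.cost (K + (-η) • L.grad K) ≤ L.cost K - η / 2 * frob (L.grad K) ^ 2 := by
  have ha := L.sqA_nonneg
  have hb := L.sqB_nonneg
  have hr := specNorm_nonneg L.R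
  have hκ0 : 0 ≤ κ := (frob_nonneg _).trans hκ
  have hw0 : 0 ≤ w := (h.val_psd hK).trace_nonneg.trans hw
  have hs0 : 0 ≤ s := (h.cov_psd hK).trace_nonneg.trans hs
  have he0 : 0 ≤ e := (frob_nonneg _).trans he
  obtain ⟨g, hg⟩ : ∃ g, g = frob (L.grad K) := ⟨_, rfl⟩
  have hg0 : 0 ≤ g := hg ▸ frob_nonneg _
  have hgN : g ≤ 2 * s * e := hg ▸ h.frob_grad_le hK hs he
  obtain ⟨N, hN⟩ : ∃ N, N = 2 * s * e := ⟨_, rfl⟩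
  rw [← hN] at hgN
  obtain ⟨c1, c2, c3, c4⟩ := step_conditions ha hb hr h.s₀_pos hw0 hκ0 hs0 hy he0 hη hN hηb
  rw [← hg]
  obtain ⟨Δ, hΔ⟩ : ∃ Δ, Δ = (-η) • L.grad K := ⟨_, rfl⟩
  rw [← hΔ]
  have hd : frob Δ = η * g := by rw [hΔ, frob_smul, abs_neg, abs_of_nonneg hη, hg]
  have hdN : frob Δ ≤ η * N := by rw [hd]; gcongr
  have hd1 : frob Δ ≤ 1 := hdN.trans c1
  have hd2 : frob Δ ^ 2 ≤ η * N := by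
    rw [sq]
    calc frob Δ * frob Δ ≤ 1 * (η * N) := mul_le_mul hd1 hdN (frob_nonneg _) zero_le_one
      _ = _ := one_mul _
  have hcond : 4 * (1 + 4 * y) * y * L.sqB * frob Δ ^ 2 ≤ 1 :=
    (mul_le_mul_of_nonneg_left hd2 (by positivity)).trans c2
  have hK' : Stable (L.cl (K + Δ)) := stable_add hK hy hY hcond
  refine ⟨hK', ?_⟩
  have hexp := h.cost_add hK hK'
  set D := L.cov (K + Δ) - L.cov K with hD
  have hDform : ∀ u v, |u ⬝ᵥ D *ᵥ v| ≤ s₀ / 4 * en u * en v := by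
    intro u v
    refine (h.cov_add_sub_form hK hy hY hs hκ hd1 hcond u v).trans ?_
    have : 2 * y * (s * (L.sqA + L.sqB * (2 + 2 * κ)) * frob Δ) ≤ s₀ / 4 := by
      have := mul_le_mul_of_nonneg_left hdN
        (show 0 ≤ 8 * y * (s * (L.sqA + L.sqB * (2 + 2 * κ))) by positivity)
      linarith
    have hu := en_nonneg u
    have hv := en_nonneg v
    gcongr
  have t1 : 2 * (L.defect K * L.cov K * Δᵀ).trace = -η * g ^ 2 := by
    have e1 : (L.grad K * (L.grad K)ᵀ).trace = g ^ 2 := by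
      rw [hg, frob_sq_eq_trace, Matrix.trace_mul_comm]
    have e2 : L.defect K * L.cov K * Δᵀ = (-η / 2) • (L.grad K * (L.grad K)ᵀ) := by
      have : L.defect K * L.cov K = (1 / 2 : ℝ) • L.grad K := by
        rw [grad, smul_smul]; norm_num
      rw [this, hΔ, Matrix.transpose_smul, Matrix.smul_mul, Matrix.mul_smul, smul_smul]
      congr 1; ring
    rw [e2, Matrix.trace_smul, e1, smul_eq_mul]; ring
  have t2 : 2 * (L.defect K * D * Δᵀ).trace ≤ η * g ^ 2 / 4 := by
    have h1 := (le_abs_self _).trans (abs_trace_mul_le_of_form hDform (L.defect K) Δ)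
    have h2 := h.frob_defect_le_grad hK
    rw [hd] at h1
    have h3 := mul_le_mul_of_nonneg_right h2 (show 0 ≤ η * g by positivity)
    rw [← hg] at h3
    nlinarith
  have t3 : (L.hess K * (Δ * L.cov (K + Δ) * Δᵀ)).trace ≤ η * g ^ 2 / 4 := by
    have hX' : (L.cov (K + Δ)).trace ≤ 2 * s := by
      have := trace_lyap_add_le hK hy hY hcond h.S_psd
      rw [trace_cert_mul_S hK] at this
      exact this.trans (by linarith)
    refine (h.trace_hess_le hK hw (h.cov_psd hK') hX').trans ?_
    rw [hd]
    have := mul_le_mul_of_nonneg_right c4 (show 0 ≤ η * g ^ 2 by positivity)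
    nlinarith
  have esplit : (L.defect K * L.cov (K + Δ) * Δᵀ).trace =
      (L.defect K * L.cov K * Δᵀ).trace + (L.defect K * D * Δᵀ).trace := by
    rw [← Matrix.trace_add, ← Matrix.add_mul, ← Matrix.mul_add, hD]
    congr 4; abel
  rw [esplit] at hexp
  nlinarith

/-- Second-order estimate of the cost near a stabilizing gain. -/
lemma Regular.exists_cost_estimate (h : L.Regular sR s₀) (hK : Stable (L.cl K)) :
    ∃ r > (0 : ℝ), ∃ c : ℝ, ∀ Δ : Matrix (Fin m) (Fin n) ℝ, frob Δ ≤ r →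
      Stable (L.cl (K + Δ)) ∧
      |L.cost (K + Δ) - L.cost K - (L.grad K * Δᵀ).trace| ≤ c * frob Δ ^ 2 := by
  have hb := L.sqB_nonneg
  have hY0 : 0 ≤ (L.cert K).trace := (cert_psd hK).trace_nonneg
  set y := (L.cert K).trace + 1 with hy
  have hy0 : 0 < y := by linarith
  have hY : (L.cert K).trace ≤ y := by linarith
  set M := 4 * (1 + 4 * y) * y * L.sqB with hM
  have hM0 : 0 ≤ M := by positivity
  set s := (L.cov K).trace with hs
  set G := 2 * y * (s * (L.sqA + L.sqB * (2 + 2 * frob K))) with hG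
  refine ⟨1 / (1 + M), by positivity, 2 * G * frob (L.defect K) +
    (specNorm L.R + L.sqB * (L.val K).trace) * (2 * s), fun Δ hΔ => ?_⟩
  have hd0 := frob_nonneg Δ
  have hd1 : frob Δ ≤ 1 := hΔ.trans (by rw [div_le_one (by positivity)]; linarith)
  have hcond : 4 * (1 + 4 * y) * y * L.sqB * frob Δ ^ 2 ≤ 1 := by
    rw [← hM]
    have h1 : frob Δ ^ 2 ≤ 1 / (1 + M) := by nlinarith
    have h2 : M * (1 / (1 + M)) ≤ 1 := by
      rw [mul_one_div, div_le_one (by positivity)]; linarith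
    exact (mul_le_mul_of_nonneg_left h1 hM0).trans h2
  have hK' := stable_add hK hy0 hY hcond
  refine ⟨hK', ?_⟩
  rw [h.cost_add hK hK']
  set D := L.cov (K + Δ) - L.cov K with hD
  have hDform : ∀ u v, |u ⬝ᵥ D *ᵥ v| ≤ (G * frob Δ) * en u * en v := by
    intro u v
    refine (h.cov_add_sub_form hK hy0 hY le_rfl le_rfl hd1 hcond u v).trans (le_of_eq ?_)
    rw [hG]; ring
  have esplit : (L.defect K * L.cov (K + Δ) * Δᵀ).trace =
      (L.defect K * L.cov K * Δᵀ).trace + (L.defect K * D * Δᵀ).trace := by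
    rw [← Matrix.trace_add, ← Matrix.add_mul, ← Matrix.mul_add, hD]
    congr 4; abel
  have egrad : (L.grad K * Δᵀ).trace = 2 * (L.defect K * L.cov K * Δᵀ).trace := by
    rw [grad, Matrix.smul_mul, Matrix.trace_smul, smul_eq_mul]
  have h1 := abs_trace_mul_le_of_form hDform (L.defect K) Δ
  have hX' : (L.cov (K + Δ)).trace ≤ 2 * s := by
    have := trace_lyap_add_le hK hy0 hY hcond h.S_psd
    rwa [trace_cert_mul_S hK] at this
  have h2 := h.trace_hess_le (Δ := Δ) hK le_rfl (h.cov_psd hK') hX'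
  have h3 := h.trace_hess_nonneg (Δ := Δ) hK (h.cov_psd hK')
  rw [esplit, egrad, show ∀ p q r : ℝ, 2 * (p + q) + r - 2 * p = 2 * q + r by intros; ring]
  refine (abs_add_le _ _).trans ?_
  rw [abs_mul, abs_two, abs_of_nonneg h3]
  nlinarith

/-! ### Gradient dominance and the optimal gain -/

/-- Gradient dominance: the suboptimality with respect to any other stabilizing gain is controlled
by `E_K`, since the expansion of the cost around `K` is at least the minimum of a quadratic. -/
lemma Regular.gradient_dominance (h : L.Regular sR s₀) (hK : Stable (L.cl K))
    (hK' : Stable (L.cl K')) {σ : ℝ} (hσ : ∀ v, v ⬝ᵥ L.cov K' *ᵥ v ≤ σ * (v ⬝ᵥ v)) :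
    sR * (L.cost K - L.cost K') ≤ σ * frob (L.defect K) ^ 2 := by
  obtain ⟨Δ, rfl⟩ : ∃ Δ, K' = K + Δ := ⟨K' - K, by abel⟩
  set X := L.cov (K + Δ) with hX
  have hXp := h.cov_psd hK'
  have hexp := h.cost_add hK hK'
  have h1 := h.trace_hess_ge (Δ := Δ) hK hXp
  have h2 := (posSemidef_conj hXp (L.defect K + sR • Δ)).trace_nonneg
  rw [← hX] at h1 h2 hexp
  have h3 : ((L.defect K + sR • Δ) * X * (L.defect K + sR • Δ)ᵀ).trace =
      (L.defect K * X * (L.defect K)ᵀ).trace + 2 * sR * (L.defect K * X * Δᵀ).trace +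
        sR ^ 2 * (Δ * X * Δᵀ).trace := by
    have := trace_mul_symm (transpose_eq_of_psd hXp) (L.defect K) Δ
    rw [← hX] at this
    simp only [Matrix.transpose_add, Matrix.transpose_smul, Matrix.add_mul, Matrix.mul_add,
      Matrix.smul_mul, Matrix.mul_smul, Matrix.trace_add, Matrix.trace_smul, smul_eq_mul]
    rw [← this]; ring
  have h4 : (L.defect K * X * (L.defect K)ᵀ).trace ≤ σ * frob (L.defect K) ^ 2 := by
    have := trace_mul_mono_of_form (M := X) (N := σ • 1) (X := (L.defect K)ᵀ * L.defect K)
      (fun v => by simpa [Matrix.smul_mulVec] using hσ v) (posSemidef_transpose_mul_self _)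
    rw [Matrix.trace_mul_comm (L.defect K * X), ← Matrix.mul_assoc, Matrix.trace_mul_comm _ X]
    simpa [frob_sq_eq_trace] using this
  have h5 := mul_le_mul_of_nonneg_left h1 h.sR_pos.le
  have h6 : sR * (L.cost K - L.cost (K + Δ)) = -(2 * sR * (L.defect K * X * Δᵀ).trace) -
      sR * (L.hess K * (Δ * X * Δᵀ)).trace := by linear_combination (-sR) * hexp
  rw [h3] at h2
  linarith

/-- At an optimal gain the gradient, hence `E_K`, vanishes. -/
lemma Regular.defect_eq_zero (h : L.Regular sR s₀) (hopt : L.IsOpt K) : L.defect K = 0 := by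
  obtain ⟨hK, hmin⟩ := hopt
  -- A gradient step of size `1 / M` would otherwise decrease the cost.
  obtain ⟨M, hM⟩ : ∃ M, M = stepBound L.sqA L.sqB (specNorm L.R) s₀⁻¹ (L.val K).trace (frob K)
    (L.cov K).trace ((L.cert K).trace + 1) (frob (L.defect K)) := ⟨_, rfl⟩
  have hc := (cert_psd hK).trace_nonneg
  have hM0 : 0 < M := by
    have := L.sqA_nonneg
    have := L.sqB_nonneg
    have := specNorm_nonneg L.R
    have := frob_nonneg K
    have := frob_nonneg (L.defect K)
    have := (h.val_psd hK).trace_nonneg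
    have := (h.cov_psd hK).trace_nonneg
    have := inv_pos.mpr h.s₀_pos
    have : 0 < (L.cert K).trace + 1 := by linarith
    rw [hM, stepBound]
    positivity
  obtain ⟨hst, hle⟩ := h.descent hK (η := 1 / M) le_rfl le_rfl le_rfl
    (y := (L.cert K).trace + 1) (by linarith) (by linarith) le_rfl (by positivity)
    (by rw [← hM]; exact (one_div_mul_cancel hM0.ne').le)
  have h1 := hmin _ hst
  have h2 : frob (L.grad K) ^ 2 ≤ 0 := by
    have h3 : 0 < 1 / M / 2 := by positivity
    by_contra hcon
    push Not at hcon
    nlinarith [mul_pos h3 hcon]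
  have h3 : frob (L.grad K) = 0 := by
    have := frob_nonneg (L.grad K)
    nlinarith
  have h4 := h.frob_defect_le_grad hK
  rw [h3] at h4
  refine eq_zero_of_frob_eq_zero (le_antisymm ?_ (frob_nonneg _))
  by_contra hcon
  push Not at hcon
  nlinarith [mul_pos h.s₀_pos hcon]

/-- The expansion of the cost around an optimal gain has no linear term. -/
lemma Regular.trace_sub_opt_le (h : L.Regular sR s₀) {Ks : Matrix (Fin m) (Fin n) ℝ}
    (hopt : L.IsOpt Ks) (hK : Stable (L.cl K)) :
    sR * ((K - Ks) * L.cov K * (K - Ks)ᵀ).trace ≤ L.cost K - L.cost Ks := by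
  have e : Ks + (K - Ks) = K := by abel
  have h1 := h.cost_add (K := Ks) (Δ := K - Ks) hopt.1 (by rwa [e])
  have h2 := h.trace_hess_ge (Δ := K - Ks) hopt.1 (h.cov_psd hK)
  rw [e, h.defect_eq_zero hopt] at h1
  simp only [Matrix.zero_mul, Matrix.trace_zero, mul_zero, zero_add] at h1
  linarith

/-- Quadratic growth of the cost away from an optimal gain. -/
lemma Regular.frob_sub_opt_le (h : L.Regular sR s₀) {Ks : Matrix (Fin m) (Fin n) ℝ}
    (hopt : L.IsOpt Ks) (hK : Stable (L.cl K)) :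
    sR * s₀ * frob (K - Ks) ^ 2 ≤ L.cost K - L.cost Ks := by
  have h1 := h.trace_sub_opt_le hopt hK
  have h2 := mul_le_mul_of_nonneg_left (frob_sq_le_trace_of_form (h.cov_ge hK) (K - Ks)) h.sR_pos.le
  linarith

/-- The aggregate second moment of any gain is controlled by that of the optimal gain and by the
cost: under `K` the system is the optimal closed loop driven by the additional input
`(K - K*) x`, whose energy is at most the suboptimality divided by `sR`. No definiteness of `Q` is
needed. -/
lemma Regular.trace_cov_le (h : L.Regular sR s₀) {Ks : Matrix (Fin m) (Fin n) ℝ}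
    (hopt : L.IsOpt Ks) (hK : Stable (L.cl K)) {τ j : ℝ} (hτ0 : 0 < τ)
    (hτ : (L.cov Ks).trace ≤ τ) (hj : L.cost K ≤ j) :
    (L.cov K).trace ≤
      2 * (τ + (1 + 4 * (s₀⁻¹ * τ)) * (s₀⁻¹ * τ) * L.sqB * (sR⁻¹ * j)) := by
  have hs₀ := h.s₀_pos
  have hsR := h.sR_pos
  set y := s₀⁻¹ * τ with hy
  have hy0 : 0 < y := by positivity
  have hX := h.cov_psd hK
  set X := L.cov K with hXdef
  have hY : (L.cert Ks).trace ≤ y := by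
    have := (h.trace_cert_le hopt.1).trans hτ
    rw [hy, inv_mul_eq_div, le_div_iff₀ hs₀]
    linarith
  set Y := L.cert Ks with hYdef
  set Δ := K - Ks with hΔ
  have e : Ks + Δ = K := by rw [hΔ]; abel
  have h1 := trace_mul_mono_of_form (M := krausOp (adjFamily (L.cl K)) Y)
    (N := Y - (3 / 4 : ℝ) • 1 + ((1 + 4 * y) * y * L.sqB) • (Δᵀ * Δ)) (fun v => by
      have := cert_form_le (Δ := Δ) hopt.1 hy0 hY v
      rw [e] at this
      simpa only [Matrix.add_mulVec, Matrix.sub_mulVec, Matrix.smul_mulVec, Matrix.one_mulVec,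
        dotProduct_add, dotProduct_sub, dotProduct_smul, smul_eq_mul, form_transpose_mul]
        using this) hX
  have h2 : (krausOp (adjFamily (L.cl K)) Y * X).trace = (Y * X).trace - (L.cov Ks).trace := by
    rw [← trace_mul_krausOp, hXdef, cov, hK.krausOp_lyap, Matrix.mul_sub, Matrix.trace_sub,
      hYdef, trace_cert_mul_S hopt.1]
  have h3 : (Δᵀ * Δ * X).trace = (Δ * X * Δᵀ).trace := by
    rw [Matrix.mul_assoc, Matrix.trace_mul_comm]
  rw [h2, Matrix.add_mul, Matrix.sub_mul, Matrix.trace_add, Matrix.trace_sub, Matrix.smul_mul,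
    Matrix.smul_mul, Matrix.one_mul, Matrix.trace_smul, Matrix.trace_smul, smul_eq_mul,
    smul_eq_mul, h3] at h1
  have h4 : (Δ * X * Δᵀ).trace ≤ sR⁻¹ * j := by
    have h5 := h.trace_sub_opt_le hopt hK
    have h6 := h.cost_nonneg hopt.1
    rw [inv_mul_eq_div, le_div_iff₀ hsR]
    linarith
  have hb := L.sqB_nonneg
  have h5 := mul_le_mul_of_nonneg_left h4 (show 0 ≤ (1 + 4 * y) * y * L.sqB by positivity)
  have h6 := hX.trace_nonneg
  have h7 := mul_nonneg (show 0 ≤ (1 + 4 * y) * y * L.sqB by positivity)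
    (posSemidef_conj hX Δ).trace_nonneg
  linarith

variable {Ks : Matrix (Fin m) (Fin n) ℝ}

/-! ### Convergence of gradient descent -/

/-- The bound on `tr Σ_K` provided by `Regular.trace_cov_le`, with `ρ = 1 / sR`, `z = 1 / s₀`. -/
def covBound {𝕜 : Type*} [CommSemiring 𝕜] (b ρ z j τ : 𝕜) : 𝕜 :=
  2 * (τ + (1 + 4 * (z * τ)) * (z * τ) * b * (ρ * j))

/-- The bound on `‖E_K‖_F` provided by `Regular.frob_defect_le`, where `‖K‖_F` and `tr P_K` have
been bounded through the cost `j`. -/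
def defectBound {𝕜 : Type*} [CommSemiring 𝕜] (a b r ρ z j : 𝕜) : 𝕜 :=
  r * (1 + ρ * z * j) + z * j * (a + b * (1 + (1 + ρ * z * j)))

/-- Reciprocal of a step size that is admissible at every gain of cost at most `j`, if the
aggregate second moment of an optimal gain has trace at most `τ`; a polynomial in its arguments.
The trace of the certificate is bounded by `z tr Σ_K`, enlarged by `1` to be positive. -/
def uniformStepBound {𝕜 : Type*} [CommSemiring 𝕜] (a b r ρ z j τ : 𝕜) : 𝕜 :=
  stepBound a b r z (z * j) (1 + ρ * z * j) (covBound b ρ z j τ) (z * covBound b ρ z j τ + 1)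
    (defectBound a b r ρ z j)

lemma uniformStepBound_pos {a b r ρ z j τ : ℝ} (ha : 0 ≤ a) (hb : 0 ≤ b) (hr : 0 ≤ r)
    (hρ : 0 ≤ ρ) (hz : 0 ≤ z) (hj : 0 ≤ j) (hτ : 0 ≤ τ) : 0 < uniformStepBound a b r ρ z j τ := by
  have h1 : 0 ≤ covBound b ρ z j τ := by unfold covBound; positivity
  have h2 : 0 ≤ defectBound a b r ρ z j := by unfold defectBound; positivity
  unfold uniformStepBound stepBound
  positivity

/-- Uniform descent on a sublevel set of the cost. -/
lemma Regular.uniform_descent (h : L.Regular sR s₀) (hopt : L.IsOpt Ks) {j τ η : ℝ} (hτ0 : 0 < τ)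
    (hτ : (L.cov Ks).trace ≤ τ) (hη : 0 ≤ η)
    (hηb : η * uniformStepBound L.sqA L.sqB (specNorm L.R) sR⁻¹ s₀⁻¹ j τ ≤ 1)
    (hK : Stable (L.cl K)) (hj : L.cost K ≤ j) :
    Stable (L.cl (K + (-η) • L.grad K)) ∧
      L.cost (K + (-η) • L.grad K) ≤ L.cost K - η / 2 * frob (L.grad K) ^ 2 := by
  have hs₀ := h.s₀_pos
  have hsR := h.sR_pos
  have hw : (L.val K).trace ≤ s₀⁻¹ * j := by
    rw [inv_mul_eq_div, le_div_iff₀ hs₀]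
    linarith [h.trace_val_le hK]
  -- `‖K‖_F ≤ 1 + ‖K‖_F²` avoids a square root.
  have hκ : frob K ≤ 1 + sR⁻¹ * s₀⁻¹ * j := by
    have h1 : frob K ^ 2 ≤ sR⁻¹ * s₀⁻¹ * j := by
      rw [← mul_inv, inv_mul_eq_div, le_div_iff₀ (by positivity)]
      linarith [h.frob_gain_le hK]
    nlinarith [sq_nonneg (frob K - 1)]
  have hs : (L.cov K).trace ≤ covBound L.sqB sR⁻¹ s₀⁻¹ j τ := h.trace_cov_le hopt hK hτ0 hτ hj
  have hY : (L.cert K).trace ≤ s₀⁻¹ * covBound L.sqB sR⁻¹ s₀⁻¹ j τ := by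
    rw [inv_mul_eq_div, le_div_iff₀ hs₀]
    linarith [h.trace_cert_le hK]
  have hY0 := (cert_psd hK).trace_nonneg
  exact h.descent hK hw hκ hs (by linarith) (by linarith) (h.frob_defect_le hK hw hκ) hη hηb

/-- The factor `c` may be negative, in which case `f` vanishes from index `1` on. -/
lemma tendsto_zero_of_contraction {f : ℕ → ℝ} {c : ℝ} (hc : c < 1) (h0 : ∀ k, 0 ≤ f k)
    (h : ∀ k, f (k + 1) ≤ c * f k) : Tendsto f atTop (𝓝 0) := by
  have hc' : max c 0 < 1 := max_lt hc one_pos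
  have hle : ∀ k, f k ≤ max c 0 ^ k * f 0 := by
    intro k
    induction k with
    | zero => simp
    | succ k ih =>
      calc f (k + 1) ≤ c * f k := h k
        _ ≤ max c 0 * f k := mul_le_mul_of_nonneg_right (le_max_left _ _) (h0 k)
        _ ≤ max c 0 * (max c 0 ^ k * f 0) := mul_le_mul_of_nonneg_left ih (le_max_right _ _)
        _ = _ := by ring
  refine squeeze_zero h0 hle ?_
  simpa using (tendsto_pow_atTop_nhds_zero_of_lt_one (le_max_right _ _) hc').mul_const (f 0)

/-- Linear convergence of gradient descent with a step size as in `uniformStepBound`: descent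
and gradient dominance give the contraction, quadratic growth the convergence of the gains. -/
theorem Regular.gradient_descent (h : L.Regular sR s₀) (hopt : L.IsOpt Ks) {τ η σ : ℝ}
    (hτ0 : 0 < τ) (hτ : (L.cov Ks).trace ≤ τ) (hσ0 : 0 < σ)
    (hσ : ∀ v, v ⬝ᵥ L.cov Ks *ᵥ v ≤ σ * (v ⬝ᵥ v)) (hη : 0 < η) {u : ℕ → Matrix (Fin m) (Fin n) ℝ}
    (hηb : η * uniformStepBound L.sqA L.sqB (specNorm L.R) sR⁻¹ s₀⁻¹ (L.cost (u 0)) τ ≤ 1)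
    (hu0 : Stable (L.cl (u 0)))
    (hu : ∀ k, Stable (L.cl (u k)) → u (k + 1) = u k - η • L.grad (u k)) :
    (∀ k, Stable (L.cl (u k)) ∧ L.cost (u (k + 1)) - L.cost Ks ≤
      (1 - η * (sR * s₀ ^ 2 / σ)) * (L.cost (u k) - L.cost Ks)) ∧
    Tendsto (fun k => L.cost (u k)) atTop (𝓝 (L.cost Ks)) ∧ Tendsto u atTop (𝓝 Ks) := by
  have hs₀ := h.s₀_pos
  have hsR := h.sR_pos
  have hu' : ∀ k, Stable (L.cl (u k)) → u (k + 1) = u k + (-η) • L.grad (u k) := by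
    intro k hk; rw [hu k hk, neg_smul, sub_eq_add_neg]
  have inv : ∀ k, Stable (L.cl (u k)) ∧ L.cost (u k) ≤ L.cost (u 0) := by
    intro k
    induction k with
    | zero => exact ⟨hu0, le_rfl⟩
    | succ k ih =>
      obtain ⟨h1, h2⟩ := h.uniform_descent hopt hτ0 hτ hη.le hηb ih.1 ih.2
      rw [hu' k ih.1]
      exact ⟨h1, by nlinarith [sq_nonneg (frob (L.grad (u k))), ih.2]⟩
  have contr : ∀ k, L.cost (u (k + 1)) - L.cost Ks ≤
      (1 - η * (sR * s₀ ^ 2 / σ)) * (L.cost (u k) - L.cost Ks) := by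
    intro k
    obtain ⟨hk, hkj⟩ := inv k
    have h1 := (h.uniform_descent hopt hτ0 hτ hη.le hηb hk hkj).2
    rw [← hu' k hk] at h1
    have h2 := h.gradient_dominance hk hopt.1 hσ
    have h3 := pow_le_pow_left₀ (mul_nonneg zero_le_two (mul_nonneg hs₀.le (frob_nonneg _)))
      (h.frob_defect_le_grad hk) 2
    have hgap : 0 ≤ L.cost (u k) - L.cost Ks := sub_nonneg.mpr (hopt.2 _ hk)
    have h4 : sR * s₀ ^ 2 / σ * (L.cost (u k) - L.cost Ks) ≤ frob (L.grad (u k)) ^ 2 / 4 := by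
      rw [div_mul_eq_mul_div, div_le_iff₀ hσ0]
      have h5 := mul_le_mul_of_nonneg_left h2 (sq_nonneg s₀)
      have h6 := mul_le_mul_of_nonneg_left h3 hσ0.le
      linarith
    have h5 := mul_le_mul_of_nonneg_left h4 hη.le
    have h6 : 0 ≤ η * frob (L.grad (u k)) ^ 2 := by positivity
    linarith
  have hlim : Tendsto (fun k => L.cost (u k) - L.cost Ks) atTop (𝓝 0) := by
    refine tendsto_zero_of_contraction (c := 1 - η * (sR * s₀ ^ 2 / σ)) ?_
      (fun k => sub_nonneg.mpr (hopt.2 _ (inv k).1)) contr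
    have : 0 < η * (sR * s₀ ^ 2 / σ) := by positivity
    linarith
  refine ⟨fun k => ⟨(inv k).1, contr k⟩, ?_, ?_⟩
  · simpa using hlim.add_const (L.cost Ks)
  · refine tendsto_pi_nhds.mpr fun i => tendsto_pi_nhds.mpr fun i' => ?_
    have hsq : Tendsto (fun k => (sR * s₀)⁻¹ * (L.cost (u k) - L.cost Ks)) atTop (𝓝 0) := by
      simpa using hlim.const_mul (sR * s₀)⁻¹
    have hroot := (Real.continuous_sqrt.tendsto 0).comp hsq
    rw [Real.sqrt_zero] at hroot
    rw [tendsto_iff_norm_sub_tendsto_zero]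
    refine squeeze_zero (fun _ => norm_nonneg _) (fun k => ?_) hroot
    have h1 := h.frob_sub_opt_le hopt (inv k).1
    have h2 := abs_apply_le_frob (u k - Ks) i i'
    refine h2.trans (Real.le_sqrt_of_sq_le ?_)
    show frob (u k - Ks) ^ 2 ≤ (sR * s₀)⁻¹ * (L.cost (u k) - L.cost Ks)
    rw [inv_mul_eq_div, le_div_iff₀ (by positivity)]
    linarith

/-! ### Differentiability of the cost -/

lemma continuous_frob : Continuous fun M : Matrix (Fin m) (Fin n) ℝ => frob M := by
  unfold frob en
  refine continuous_norm.comp ((PiLp.continuous_toLp 2 _).comp ?_)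
  fun_prop

lemma eventually_frob_sub_lt (K : Matrix (Fin m) (Fin n) ℝ) {r : ℝ} (hr : 0 < r) :
    ∀ᶠ K' in 𝓝 K, frob (K' - K) < r := by
  have hc : Continuous fun K' : Matrix (Fin m) (Fin n) ℝ => frob (K' - K) :=
    continuous_frob.comp (continuous_id.sub continuous_const)
  refine hc.continuousAt.eventually_lt continuousAt_const ?_
  simpa [frob_zero] using hr

/-- The trace pairing with `G`, as a continuous linear functional. -/
def tracePairing (G : Matrix (Fin m) (Fin n) ℝ) : Matrix (Fin m) (Fin n) ℝ →L[ℝ] ℝ where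
  toFun Δ := (G * Δᵀ).trace
  map_add' X Y := by simp [Matrix.mul_add]
  map_smul' c X := by simp
  cont := by fun_prop

lemma frob_sq_le_card_mul {k l : ℕ} (M : Matrix (Fin k) (Fin l) ℝ) {c : ℝ}
    (h : ∀ i j, |M i j| ≤ c) : frob M ^ 2 ≤ k * l * c ^ 2 := by
  rw [frob_sq]
  simp only [en_sq, dotProduct]
  calc ∑ i, ∑ j, M i j * M i j ≤ ∑ _i : Fin k, ∑ _j : Fin l, c ^ 2 := by
        refine Finset.sum_le_sum fun i _ => Finset.sum_le_sum fun j _ => ?_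
        rw [← sq, ← sq_abs]
        exact pow_le_pow_left₀ (abs_nonneg _) (h i j) 2
    _ = _ := by simp; ring

/-- A function agreeing with the cost at stabilizing gains has the policy gradient as derivative
at every stabilizing gain. -/
lemma Regular.hasFDerivAt_of_eq_cost (h : L.Regular sR s₀) (hK : Stable (L.cl K))
    {f : Matrix (Fin m) (Fin n) ℝ → ℝ} (hf : ∀ K, Stable (L.cl K) → f K = L.cost K) :
    HasFDerivAt f (tracePairing (L.grad K)) K := by
  -- The sup norm induces the product topology in which the derivative is taken.
  let _ : NormedAddCommGroup (Matrix (Fin m) (Fin n) ℝ) := Matrix.normedAddCommGroup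
  let _ : NormedSpace ℝ (Matrix (Fin m) (Fin n) ℝ) := Matrix.normedSpace
  obtain ⟨r, hr, c, hc⟩ := h.exists_cost_estimate hK
  refine HasFDerivAt.of_isLittleO ?_
  have hO : (fun K' => f K' - f K - tracePairing (L.grad K) (K' - K)) =O[𝓝 K]
      fun K' => ‖K' - K‖ ^ 2 := by
    refine Asymptotics.IsBigO.of_bound (|c| * (m * n)) ?_
    filter_upwards [eventually_frob_sub_lt K hr] with K' hK'
    obtain ⟨h1, h2⟩ := hc (K' - K) hK'.le
    rw [add_sub_cancel] at h1 h2
    rw [hf _ h1, hf _ hK, Real.norm_eq_abs, Real.norm_eq_abs,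
      abs_of_nonneg (sq_nonneg ‖K' - K‖)]
    have h3 : frob (K' - K) ^ 2 ≤ m * n * ‖K' - K‖ ^ 2 :=
      frob_sq_le_card_mul _ fun i j =>
        Matrix.norm_entry_le_entrywise_sup_norm (K' - K)
    calc _ ≤ c * frob (K' - K) ^ 2 := h2
      _ ≤ |c| * frob (K' - K) ^ 2 := mul_le_mul_of_nonneg_right (le_abs_self c) (sq_nonneg _)
      _ ≤ |c| * (m * n * ‖K' - K‖ ^ 2) := mul_le_mul_of_nonneg_left h3 (abs_nonneg c)
      _ = _ := by ring
  refine hO.trans_isLittleO ?_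
  exact (Asymptotics.isLittleO_norm_pow_id one_lt_two).comp_tendsto
    (tendsto_sub_nhds_zero_iff.mpr tendsto_id)

lemma tracePairing_single (G : Matrix (Fin m) (Fin n) ℝ) (i : Fin m) (j : Fin n) :
    tracePairing G (Matrix.single i j 1) = G i j := by
  show (G * (Matrix.single i j (1 : ℝ))ᵀ).trace = G i j
  rw [Matrix.transpose_single, Matrix.trace_mul_single]
  simp

/-! ### Existence of an optimal gain -/

lemma Regular.trace_cov_le_of_Q_ge (h : L.Regular sR s₀) {q : ℝ}
    (hQ : ∀ v, q * (v ⬝ᵥ v) ≤ v ⬝ᵥ L.Q *ᵥ v) (hK : Stable (L.cl K)) :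
    q * (L.cov K).trace ≤ L.cost K := by
  have h2 := trace_mul_mono_of_form (M := q • 1) (N := L.stageMat K) (fun v => by
    have := form_nonneg (posSemidef_conj_transpose h.R_psd K) v
    rw [Matrix.smul_mulVec, Matrix.one_mulVec, dotProduct_smul, smul_eq_mul, stageMat,
      Matrix.add_mulVec, dotProduct_add]
    linarith [hQ v]) (h.cov_psd hK)
  rwa [Matrix.smul_mul, Matrix.one_mul, Matrix.trace_smul, smul_eq_mul] at h2

/-- If `Q ≥ q > 0`, an optimal gain exists: a sublevel set of the cost is bounded, and closed
because all its gains share a positive radius of stability. -/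
lemma Regular.exists_isOpt (h : L.Regular sR s₀) {q : ℝ} (hq : 0 < q)
    (hQ : ∀ v, q * (v ⬝ᵥ v) ≤ v ⬝ᵥ L.Q *ᵥ v) {K₀ : Matrix (Fin m) (Fin n) ℝ}
    (hK₀ : Stable (L.cl K₀)) : ∃ Ks, L.IsOpt Ks := by
  have hs₀ := h.s₀_pos
  have hsR := h.sR_pos
  have hb := L.sqB_nonneg
  set j := L.cost K₀ with hj
  have hj0 : 0 ≤ j := h.cost_nonneg hK₀
  set T : Set (Matrix (Fin m) (Fin n) ℝ) := {K | Stable (L.cl K) ∧ L.cost K ≤ j} with hT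
  have hcont : ∀ K, Stable (L.cl K) → ContinuousAt L.cost K := fun K hK =>
    (h.hasFDerivAt_of_eq_cost hK fun _ _ => rfl).continuousAt
  set y := s₀⁻¹ * (q⁻¹ * j) + 1 with hy
  have hy0 : 0 < y := by positivity
  have hcert : ∀ K ∈ T, (L.cert K).trace ≤ y := by
    rintro K ⟨hK, hKj⟩
    have h1 := (h.trace_cov_le_of_Q_ge hQ hK).trans hKj
    have h2 := h.trace_cert_le hK
    have h3 : (L.cov K).trace ≤ q⁻¹ * j := by
      rw [inv_mul_eq_div, le_div_iff₀ hq]; linarith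
    have h4 : (L.cert K).trace ≤ s₀⁻¹ * (q⁻¹ * j) := by
      rw [inv_mul_eq_div, le_div_iff₀ hs₀]; linarith
    linarith
  obtain ⟨r, hr, hrb⟩ : ∃ r > 0, ∀ d, 0 ≤ d → d < r → 4 * (1 + 4 * y) * y * L.sqB * d ^ 2 ≤ 1 := by
    have hM0 : 0 ≤ 4 * (1 + 4 * y) * y * L.sqB := by positivity
    set M := 4 * (1 + 4 * y) * y * L.sqB
    refine ⟨1 / (1 + M), by positivity, fun d hd0 hd => ?_⟩
    have hd1 : d ≤ 1 := hd.le.trans (by rw [div_le_one (by positivity)]; linarith)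
    have h1 : d ^ 2 ≤ 1 / (1 + M) := by nlinarith
    have h2 : M * (1 / (1 + M)) ≤ 1 := by
      rw [mul_one_div, div_le_one (by positivity)]; linarith
    exact (mul_le_mul_of_nonneg_left h1 hM0).trans h2
  have hclosed : IsClosed T := by
    refine isClosed_of_closure_subset fun K hK => ?_
    have hfreq := mem_closure_iff_frequently.mp hK
    -- Gains of `T` arbitrarily close to `K` have `K` within their common radius of stability.
    have hKst : Stable (L.cl K) := by
      obtain ⟨K', hK'T, hK'r⟩ := (hfreq.and_eventually (eventually_frob_sub_lt K hr)).exists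
      have e : K = K' + (K - K') := by abel
      have e2 : frob (K - K') = frob (K' - K) := by
        have := frob_smul (-1) (K' - K)
        simpa using this
      rw [e]
      exact stable_add hK'T.1 hy0 (hcert _ hK'T) (hrb _ (frob_nonneg _) (by rwa [e2]))
    refine ⟨hKst, ?_⟩
    exact le_of_tendsto_of_frequently (hcont K hKst) (hfreq.mono fun _ hx => hx.2)
  have hcompact : IsCompact T := by
    set c := 1 + (sR * s₀)⁻¹ * j with hc
    have hbox : IsCompact (Set.pi Set.univ fun _ : Fin m => Set.pi Set.univ fun _ : Fin n =>
        Set.Icc (-c) c) :=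
      isCompact_univ_pi fun _ => isCompact_univ_pi fun _ => isCompact_Icc
    refine IsCompact.of_isClosed_subset hbox hclosed ?_
    rintro K ⟨hK, hKj⟩ i _ i' _
    have h1 : frob K ^ 2 ≤ (sR * s₀)⁻¹ * j := by
      rw [inv_mul_eq_div, le_div_iff₀ (by positivity)]
      linarith [h.frob_gain_le hK]
    have h2 : |K i i'| ≤ c := (abs_apply_le_frob K i i').trans (by
      nlinarith [sq_nonneg (frob K - 1)])
    exact abs_le.mp h2
  obtain ⟨Ks, hKs, hmin⟩ := hcompact.exists_isMinOn ⟨K₀, hK₀, le_rfl⟩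
    (fun K hK => (hcont K hK.1).continuousWithinAt)
  refine ⟨Ks, hKs.1, fun K hK => ?_⟩
  rcases le_total (L.cost K) j with hle | hle
  · exact hmin (show K ∈ T from ⟨hK, hle⟩)
  · exact hKs.2.trans hle

end MomentLQR

/-! ### The second moments of the state -/

variable {n m p q : ℕ} {Ω : Type*}
  {S : LQRm n m p q} {δ : Fin p → ℕ → Ω → ℝ} {γ : Fin q → ℕ → Ω → ℝ}
  {K : Matrix (Fin m) (Fin n) ℝ} {x : Ω → Fin n → ℝ}

/-- The deterministic second-moment problem: the index `none` carries the nominal dynamics, the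
other indices carry one noise each, scaled by its standard deviation. -/
def toMoment (S : LQRm n m p q) (S₀ : Matrix (Fin n) (Fin n) ℝ) :
    MomentLQR (Option (Fin p ⊕ Fin q)) n m where
  A a := Option.elim a S.A (Sum.elim (fun i => √(S.α i) • S.Ai i) fun _ => 0)
  B a := Option.elim a S.B (Sum.elim (fun _ => 0) fun j => √(S.β j) • S.Bj j)
  Q := S.Q
  R := S.R
  S := S₀

/-- Coefficient of the random dynamics at time `t`: `1` for the nominal part, and the noises. -/
def coef (δ : Fin p → ℕ → Ω → ℝ) (γ : Fin q → ℕ → Ω → ℝ) (t : ℕ) (a : Option (Fin p ⊕ Fin q)) :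
    Ω → ℝ :=
  Option.elim a (fun _ => 1) fun b => noiseFamily δ γ (b, t)

/-- Closed-loop matrix multiplying the coefficient with index `a`. -/
def loopMat (S : LQRm n m p q) (K : Matrix (Fin m) (Fin n) ℝ) (a : Option (Fin p ⊕ Fin q)) :
    Matrix (Fin n) (Fin n) ℝ :=
  Option.elim a (S.A + S.B * K) (Sum.elim S.Ai fun j => S.Bj j * K)

/-- Variance of the coefficient with index `a`, the nominal one counting as `1`. -/
def coefVar (S : LQRm n m p q) (a : Option (Fin p ⊕ Fin q)) : ℝ :=
  Option.elim a 1 (Sum.elim S.α S.β)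

lemma state_succ (t : ℕ) (ω : Ω) :
    S.state δ γ K x (t + 1) ω = ∑ a, coef δ γ t a ω • (S.loopMat K a *ᵥ S.state δ γ K x t ω) := by
  simp only [state, Fintype.sum_option, Fintype.sum_sum_type, coef, loopMat, noiseFamily,
    Option.elim, Sum.elim_inl, Sum.elim_inr, Matrix.add_mulVec, Matrix.sum_mulVec,
    Matrix.smul_mulVec, ← Matrix.mulVec_mulVec, one_smul]
  abel

/-- Indices of the noises before time `t`. -/
def pastNoise (p q t : ℕ) : Finset ((Fin p ⊕ Fin q) × ℕ) := Finset.univ ×ˢ Finset.range t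

/-- The state at time `t ≤ T` is a measurable function of the initial state and of the noises
before time `T`. -/
lemma exists_state_eq (S : LQRm n m p q) (δ : Fin p → ℕ → Ω → ℝ) (γ : Fin q → ℕ → Ω → ℝ)
    (K : Matrix (Fin m) (Fin n) ℝ) (x : Ω → Fin n → ℝ) (T t : ℕ) (ht : t ≤ T) :
    ∃ f : (Fin n → ℝ) × (pastNoise p q T → ℝ) → Fin n → ℝ, Measurable f ∧
      ∀ ω, S.state δ γ K x t ω = f (x ω, fun a => noiseFamily δ γ a ω) := by
  induction t with
  | zero => exact ⟨Prod.fst, measurable_fst, fun ω => rfl⟩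
  | succ t ih =>
    obtain ⟨f, hf, hfe⟩ := ih (by omega)
    have hmem : ∀ b : Fin p ⊕ Fin q, (b, t) ∈ pastNoise p q T := fun b => by
      simp [pastNoise]; omega
    refine ⟨fun w => ∑ a : Option (Fin p ⊕ Fin q),
      (Option.elim a 1 fun b => w.2 ⟨(b, t), hmem b⟩) • (S.loopMat K a *ᵥ f w), ?_, fun ω => ?_⟩
    · refine Finset.measurable_sum _ fun a _ => Measurable.fun_smul ?_ ?_
      · rcases a with _ | b
        · exact measurable_const
        · exact (measurable_pi_apply _).comp measurable_snd
      · have hc : Continuous fun v : Fin n → ℝ => S.loopMat K a *ᵥ v := by fun_prop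
        exact hc.measurable.comp hf
    · rw [state_succ]
      simp only [← hfe]
      refine Finset.sum_congr rfl fun a _ => ?_
      rcases a with _ | b <;> rfl

variable [MeasurableSpace Ω] {μ : Measure Ω}

lemma memLp_mulVec {X : Ω → Fin n → ℝ} (hX : ∀ i, MemLp (fun ω => X ω i) 2 μ)
    (M : Matrix (Fin n) (Fin n) ℝ) (i : Fin n) : MemLp (fun ω => (M *ᵥ X ω) i) 2 μ := by
  simp only [Matrix.mulVec, dotProduct]
  exact memLp_finsetSum _ fun k _ => (hX k).const_mul (M i k)

lemma integral_mulVec_mul {X : Ω → Fin n → ℝ} (hX : ∀ i, MemLp (fun ω => X ω i) 2 μ)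
    (M : Matrix (Fin n) (Fin n) ℝ) (i j : Fin n) :
    ∫ ω, (M *ᵥ X ω) i * (M *ᵥ X ω) j ∂μ = (M * secondMoment μ X * Mᵀ) i j := by
  have e : ∀ ω, (M *ᵥ X ω) i * (M *ᵥ X ω) j =
      ∑ l, ∑ k, (M i k * M j l) * (X ω k * X ω l) := by
    intro ω
    simp only [Matrix.mulVec, dotProduct, Finset.sum_mul_sum]
    rw [Finset.sum_comm]
    refine Finset.sum_congr rfl fun l _ => Finset.sum_congr rfl fun k _ => by ring
  simp only [e]
  have hint : ∀ k l, Integrable (fun ω => (M i k * M j l) * (X ω k * X ω l)) μ := fun k l =>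
    ((hX k).integrable_mul (hX l)).const_mul _
  rw [integral_finsetSum _ fun l _ => integrable_finsetSum _ fun k _ => hint k l]
  rw [Matrix.mul_apply]
  refine Finset.sum_congr rfl fun l _ => ?_
  rw [integral_finsetSum _ fun k _ => hint k l, Matrix.mul_apply, Finset.sum_mul]
  refine Finset.sum_congr rfl fun k _ => ?_
  rw [integral_const_mul, Matrix.transpose_apply, secondMoment, Matrix.of_apply]
  ring

lemma integral_form {X : Ω → Fin n → ℝ} (hX : ∀ i, MemLp (fun ω => X ω i) 2 μ)
    (M : Matrix (Fin n) (Fin n) ℝ) :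
    Integrable (fun ω => X ω ⬝ᵥ M *ᵥ X ω) μ ∧
      ∫ ω, X ω ⬝ᵥ M *ᵥ X ω ∂μ = (M * secondMoment μ X).trace := by
  have e : ∀ ω, X ω ⬝ᵥ M *ᵥ X ω = ∑ i, ∑ j, M i j * (X ω j * X ω i) := by
    intro ω
    simp only [Matrix.mulVec, dotProduct, Finset.mul_sum]
    refine Finset.sum_congr rfl fun i _ => Finset.sum_congr rfl fun j _ => by ring
  have hint : ∀ i j, Integrable (fun ω => M i j * (X ω j * X ω i)) μ := fun i j =>
    ((hX j).integrable_mul (hX i)).const_mul _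
  simp only [e]
  refine ⟨integrable_finsetSum _ fun i _ => integrable_finsetSum _ fun j _ => hint i j, ?_⟩
  rw [integral_finsetSum _ fun i _ => integrable_finsetSum _ fun j _ => hint i j, Matrix.trace]
  refine Finset.sum_congr rfl fun i _ => ?_
  rw [integral_finsetSum _ fun j _ => hint i j, Matrix.diag, Matrix.mul_apply]
  refine Finset.sum_congr rfl fun j _ => ?_
  rw [integral_const_mul, secondMoment, Matrix.of_apply]

lemma IsNoise.measurable_noise (h : S.IsNoise μ δ γ) (a : (Fin p ⊕ Fin q) × ℕ) :
    Measurable (noiseFamily δ γ a) := by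
  rcases a with ⟨i | j, t⟩
  · exact h.measurable_δ i t
  · exact h.measurable_γ j t

lemma IsNoise.memLp_noise (h : S.IsNoise μ δ γ) (a : (Fin p ⊕ Fin q) × ℕ) :
    MemLp (noiseFamily δ γ a) 2 μ := by
  rcases a with ⟨i | j, t⟩
  · exact h.memLp_δ i t
  · exact h.memLp_γ j t

lemma IsNoise.integral_noise (h : S.IsNoise μ δ γ) (a : (Fin p ⊕ Fin q) × ℕ) :
    ∫ ω, noiseFamily δ γ a ω ∂μ = 0 := by
  rcases a with ⟨i | j, t⟩
  · exact h.mean_δ i t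
  · exact h.mean_γ j t

lemma IsNoise.integral_noise_sq (h : S.IsNoise μ δ γ) (b : Fin p ⊕ Fin q) (t : ℕ) :
    ∫ ω, noiseFamily δ γ (b, t) ω * noiseFamily δ γ (b, t) ω ∂μ = S.coefVar (some b) := by
  have h1 := variance_of_integral_eq_zero (h.measurable_noise (b, t)).aemeasurable
    (h.integral_noise (b, t))
  have h2 : variance (noiseFamily δ γ (b, t)) μ = S.coefVar (some b) := by
    rcases b with i | j
    · exact h.var_δ i t
    · exact h.var_γ j t
  rw [← h2, h1]
  refine integral_congr_ae (Eventually.of_forall fun ω => ?_)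
  simp [sq]

lemma IsNoise.coefVar_nonneg (h : S.IsNoise μ δ γ) (a : Option (Fin p ⊕ Fin q)) :
    0 ≤ S.coefVar a := by
  rcases a with _ | i | j
  · exact zero_le_one
  · exact (variance_nonneg (δ i 0) μ).trans_eq (h.var_δ i 0)
  · exact (variance_nonneg (γ j 0) μ).trans_eq (h.var_γ j 0)

lemma IsNoise.measurable_coef (h : S.IsNoise μ δ γ) (t : ℕ) (a : Option (Fin p ⊕ Fin q)) :
    Measurable (coef δ γ t a) := by
  rcases a with _ | b
  · exact measurable_const
  · exact h.measurable_noise (b, t)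

lemma IsNoise.measurable_state (h : S.IsNoise μ δ γ) (hx : IsInitialState μ δ γ x) (t : ℕ) :
    Measurable (S.state δ γ K x t) := by
  obtain ⟨f, hf, hfe⟩ := S.exists_state_eq δ γ K x t t le_rfl
  rw [show S.state δ γ K x t = fun ω => f (x ω, fun a => noiseFamily δ γ a ω) from funext hfe]
  exact hf.comp (hx.measurable.prodMk (measurable_pi_lambda _ fun a => h.measurable_noise a))

variable [IsProbabilityMeasure μ]

/-- Two-stage independence: if `X` is independent of `(Y, Z)`, and `Y` of `Z`, then `(X, Y)` is
independent of `Z`. -/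
lemma indepFun_prodMk_of_indepFun {α β κ : Type*} [MeasurableSpace α] [MeasurableSpace β]
    [MeasurableSpace κ] {X : Ω → α} {Y : Ω → β} {Z : Ω → κ} (hX : Measurable X)
    (hY : Measurable Y) (hZ : Measurable Z) (h1 : IndepFun X (fun ω => (Y ω, Z ω)) μ)
    (h2 : IndepFun Y Z μ) : IndepFun (fun ω => (X ω, Y ω)) Z μ := by
  rw [indepFun_iff_map_prod_eq_prod_map_map (by fun_prop) (by fun_prop)] at h1 h2 ⊢
  have h3 : IndepFun X Y μ := by
    rw [← indepFun_iff_map_prod_eq_prod_map_map (by fun_prop) (by fun_prop)] at h1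
    exact h1.comp measurable_id measurable_fst
  rw [indepFun_iff_map_prod_eq_prod_map_map (by fun_prop) (by fun_prop)] at h3
  have : IsProbabilityMeasure (μ.map X) := Measure.isProbabilityMeasure_map hX.aemeasurable
  have : IsProbabilityMeasure (μ.map Y) := Measure.isProbabilityMeasure_map hY.aemeasurable
  have : IsProbabilityMeasure (μ.map Z) := Measure.isProbabilityMeasure_map hZ.aemeasurable
  rw [h2, ← Measure.prodAssoc_prod] at h1
  refine MeasurableEquiv.prodAssoc.map_measurableEquiv_injective ?_
  rw [h3]
  refine Eq.trans ?_ h1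
  rw [Measure.map_map (by fun_prop) (by fun_prop)]
  rfl

/-- Indices of the noises at time `t`. -/
def presentNoise (p q t : ℕ) : Finset ((Fin p ⊕ Fin q) × ℕ) := Finset.univ ×ˢ {t}

lemma IsNoise.memLp_coef (h : S.IsNoise μ δ γ) (t : ℕ) (a : Option (Fin p ⊕ Fin q)) :
    MemLp (coef δ γ t a) 2 μ := by
  rcases a with _ | b
  · exact memLp_const 1
  · exact h.memLp_noise (b, t)

lemma IsNoise.integral_coef_mul_coef (h : S.IsNoise μ δ γ) (t : ℕ)
    (a b : Option (Fin p ⊕ Fin q)) :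
    ∫ ω, coef δ γ t a ω * coef δ γ t b ω ∂μ = if a = b then S.coefVar a else 0 := by
  rcases a with _ | a <;> rcases b with _ | b
  · simp [coef, coefVar]
  · simpa [coef] using h.integral_noise (b, t)
  · simpa [coef] using h.integral_noise (a, t)
  · rcases eq_or_ne a b with rfl | hab
    · simpa [coef] using h.integral_noise_sq a t
    · have hi : IndepFun (noiseFamily δ γ (a, t)) (noiseFamily δ γ (b, t)) μ :=
        h.indep.indepFun (by simpa using hab)
      have := hi.integral_fun_mul_eq_mul_integral
        (h.measurable_noise _).aestronglyMeasurable (h.measurable_noise _).aestronglyMeasurable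
      rw [h.integral_noise] at this
      simpa [coef, hab] using this

/-- The state at time `t` is independent of the noises at time `t`. -/
lemma IsNoise.indepFun_state (h : S.IsNoise μ δ γ) (hx : IsInitialState μ δ γ x) (t : ℕ) :
    IndepFun (S.state δ γ K x t)
      (fun ω (a : presentNoise p q t) => noiseFamily δ γ a ω) μ := by
  obtain ⟨f, hf, hfe⟩ := S.exists_state_eq δ γ K x t t le_rfl
  have hpast : Measurable fun ω (a : pastNoise p q t) => noiseFamily δ γ a ω :=
    measurable_pi_lambda _ fun a => h.measurable_noise a
  have hpres : Measurable fun ω (a : presentNoise p q t) => noiseFamily δ γ a ω :=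
    measurable_pi_lambda _ fun a => h.measurable_noise a
  have hdisj : Disjoint (pastNoise p q t) (presentNoise p q t) := by
    rw [Finset.disjoint_left]
    rintro ⟨b, k⟩ h1 h2
    simp [pastNoise, presentNoise] at h1 h2
    omega
  have h1 := h.indep.indepFun_finset _ _ hdisj h.measurable_noise
  have h2 : IndepFun x (fun ω => ((fun a : pastNoise p q t => noiseFamily δ γ a ω),
      fun a : presentNoise p q t => noiseFamily δ γ a ω)) μ :=
    hx.indep.comp (φ := id) (ψ := fun w : (Fin p ⊕ Fin q) × ℕ → ℝ =>
      ((fun a : pastNoise p q t => w a), fun a : presentNoise p q t => w a)) measurable_id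
      (by fun_prop)
  have h3 := indepFun_prodMk_of_indepFun hx.measurable hpast hpres h2 h1
  rw [show S.state δ γ K x t = fun ω => f (x ω, fun a => noiseFamily δ γ a ω) from funext hfe]
  exact h3.comp hf measurable_id

lemma IsNoise.indepFun_coef_mul (h : S.IsNoise μ δ γ) (hx : IsInitialState μ δ γ x) (t : ℕ)
    (a b : Option (Fin p ⊕ Fin q)) {g : (Fin n → ℝ) → ℝ} (hg : Measurable g) :
    IndepFun (fun ω => coef δ γ t a ω * coef δ γ t b ω) (fun ω => g (S.state δ γ K x t ω)) μ := by
  have hmem : ∀ c : Fin p ⊕ Fin q, (c, t) ∈ presentNoise p q t := fun c => by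
    simp [presentNoise]
  have key := (h.indepFun_state (K := K) hx t).symm.comp
    (φ := fun w : presentNoise p q t → ℝ =>
      (Option.elim a 1 fun c => w ⟨(c, t), hmem c⟩) * (Option.elim b 1 fun c => w ⟨(c, t), hmem c⟩))
    (ψ := g) (by
      refine Measurable.mul ?_ ?_
      · rcases a with _ | a
        · exact measurable_const
        · exact measurable_pi_apply _
      · rcases b with _ | b
        · exact measurable_const
        · exact measurable_pi_apply _) hg
  have e : (fun ω => coef δ γ t a ω * coef δ γ t b ω) =
      (fun w : presentNoise p q t → ℝ =>
        (Option.elim a 1 fun c => w ⟨(c, t), hmem c⟩) *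
          (Option.elim b 1 fun c => w ⟨(c, t), hmem c⟩)) ∘
        (fun ω (a : presentNoise p q t) => noiseFamily δ γ a ω) := by
    funext ω
    rcases a with _ | a <;> rcases b with _ | b <;> rfl
  rw [e]
  exact key

lemma IsNoise.memLp_state (h : S.IsNoise μ δ γ) (hx : IsInitialState μ δ γ x) (t : ℕ) (i : Fin n) :
    MemLp (fun ω => S.state δ γ K x t ω i) 2 μ := by
  induction t generalizing i with
  | zero => exact hx.memLp i
  | succ t ih =>
    simp only [state_succ, Finset.sum_apply, Pi.smul_apply, smul_eq_mul]
    refine memLp_finsetSum _ fun a _ => ?_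
    have hm : Measurable fun ω => (S.loopMat K a *ᵥ S.state δ γ K x t ω) i := by
      have hc : Continuous fun v : Fin n → ℝ => (S.loopMat K a *ᵥ v) i := by fun_prop
      exact hc.measurable.comp (h.measurable_state hx t)
    have hL := memLp_mulVec ih (S.loopMat K a) i
    refine (memLp_two_iff_integrable_sq
      ((h.measurable_coef t a).mul hm).aestronglyMeasurable).mpr ?_
    have hc : Continuous fun v : Fin n → ℝ => ((S.loopMat K a *ᵥ v) i) ^ 2 := by fun_prop
    have hi := (h.indepFun_coef_mul (K := K) hx t a a hc.measurable).integrable_mul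
      ((h.memLp_coef t a).integrable_mul (h.memLp_coef t a)) hL.integrable_sq
    refine hi.congr (Eventually.of_forall fun ω => ?_)
    simp only [Pi.mul_apply]; ring

lemma integrable_state_mul (h : S.IsNoise μ δ γ) (hx : IsInitialState μ δ γ x) (t : ℕ)
    (i j : Fin n) :
    Integrable (fun ω => S.state δ γ K x t ω i * S.state δ γ K x t ω j) μ :=
  (h.memLp_state hx t i).integrable_mul (h.memLp_state hx t j)

lemma toMoment_cl (S : LQRm n m p q) (S₀ : Matrix (Fin n) (Fin n) ℝ)
    (K : Matrix (Fin m) (Fin n) ℝ) (a : Option (Fin p ⊕ Fin q)) :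
    (S.toMoment S₀).cl K a = √(S.coefVar a) • S.loopMat K a := by
  rcases a with _ | i | j <;> simp [toMoment, MomentLQR.cl, coefVar, loopMat]

/-- One step of the second-moment recursion: expanding the product, the mixed terms vanish because
distinct coefficients are uncorrelated and independent of the state. -/
lemma IsNoise.secondMoment_succ (h : S.IsNoise μ δ γ) (hx : IsInitialState μ δ γ x)
    (S₀ : Matrix (Fin n) (Fin n) ℝ) (t : ℕ) :
    secondMoment μ (S.state δ γ K x (t + 1)) =
      krausOp ((S.toMoment S₀).cl K) (secondMoment μ (S.state δ γ K x t)) := by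
  ext i j
  have hL := fun i => h.memLp_state (K := K) hx t i
  set y : Option (Fin p ⊕ Fin q) → Fin n → Ω → ℝ :=
    fun a i ω => (S.loopMat K a *ᵥ S.state δ γ K x t ω) i with hy
  have hyL : ∀ a i, MemLp (y a i) 2 μ := fun a i => memLp_mulVec hL (S.loopMat K a) i
  have hgm : ∀ a b,
      Measurable fun v : Fin n → ℝ => (S.loopMat K a *ᵥ v) i * (S.loopMat K b *ᵥ v) j := by
    intro a b
    have hc : Continuous fun v : Fin n → ℝ =>
        (S.loopMat K a *ᵥ v) i * (S.loopMat K b *ᵥ v) j := by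
      fun_prop
    exact hc.measurable
  have hind : ∀ a b, IndepFun (fun ω => coef δ γ t a ω * coef δ γ t b ω)
      (fun ω => y a i ω * y b j ω) μ := fun a b => h.indepFun_coef_mul hx t a b (hgm a b)
  have hint : ∀ a b, Integrable
      (fun ω => (coef δ γ t a ω * coef δ γ t b ω) * (y a i ω * y b j ω)) μ := fun a b =>
    (hind a b).integrable_mul ((h.memLp_coef t a).integrable_mul (h.memLp_coef t b))
      ((hyL a i).integrable_mul (hyL b j))
  have e : ∀ ω, S.state δ γ K x (t + 1) ω i * S.state δ γ K x (t + 1) ω j =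
      ∑ a, ∑ b, (coef δ γ t a ω * coef δ γ t b ω) * (y a i ω * y b j ω) := by
    intro ω
    rw [state_succ]
    simp only [Finset.sum_apply, Pi.smul_apply, smul_eq_mul, Finset.sum_mul_sum, hy]
    refine Finset.sum_congr rfl fun a _ => Finset.sum_congr rfl fun b _ => by ring
  rw [secondMoment, Matrix.of_apply]
  simp only [e]
  rw [integral_finsetSum _ fun a _ => integrable_finsetSum _ fun b _ => hint a b, krausOp_apply,
    Matrix.sum_apply]
  refine Finset.sum_congr rfl fun a _ => ?_
  rw [integral_finsetSum _ fun b _ => hint a b]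
  have hterm : ∀ b, ∫ ω, (coef δ γ t a ω * coef δ γ t b ω) * (y a i ω * y b j ω) ∂μ =
      (if a = b then S.coefVar a else 0) * ∫ ω, y a i ω * y b j ω ∂μ := by
    intro b
    rw [(hind a b).integral_fun_mul_eq_mul_integral
      ((h.measurable_coef t a).mul (h.measurable_coef t b)).aestronglyMeasurable
      ((hgm a b).comp (h.measurable_state hx t)).aestronglyMeasurable,
      h.integral_coef_mul_coef]
  simp only [hterm, ite_mul, zero_mul, Finset.sum_ite_eq, Finset.mem_univ, if_true]
  have h2 := integral_mulVec_mul hL (S.loopMat K a) i j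
  rw [show (∫ ω, y a i ω * y a j ω ∂μ) = _ from h2, toMoment_cl, Matrix.transpose_smul,
    Matrix.smul_mul, Matrix.smul_mul, Matrix.mul_smul, smul_smul,
    Real.mul_self_sqrt (h.coefVar_nonneg a), Matrix.smul_apply, smul_eq_mul]

lemma IsNoise.secondMoment_state (h : S.IsNoise μ δ γ) (hx : IsInitialState μ δ γ x)
    (S₀ : Matrix (Fin n) (Fin n) ℝ) (t : ℕ) :
    secondMoment μ (S.state δ γ K x t) =
      (krausOp ((S.toMoment S₀).cl K) ^ t) (secondMoment μ x) := by
  induction t with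
  | zero => rfl
  | succ t ih =>
    rw [h.secondMoment_succ hx S₀, ih, pow_succ', Module.End.mul_apply]

lemma isInitialState_const (v : Fin n → ℝ) : IsInitialState μ δ γ fun _ => v where
  measurable := measurable_const
  memLp i := memLp_const (v i)
  indep := indepFun_const_left v _

/-- A gain is mean-square stabilizing exactly if the second-moment recursion is stable; the
deterministic initial states already detect this. -/
lemma IsNoise.msStabilizing_iff (h : S.IsNoise μ δ γ) (S₀ : Matrix (Fin n) (Fin n) ℝ) :
    S.MSStabilizing μ δ γ K ↔ Stable ((S.toMoment S₀).cl K) := by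
  constructor
  · intro hK
    refine stable_of_trace_one ?_
    -- The identity is the sum of the second moments of the deterministic unit vectors.
    have hone : (1 : Matrix (Fin n) (Fin n) ℝ) =
        ∑ k, secondMoment μ fun _ : Ω => (Pi.single k 1 : Fin n → ℝ) := by
      ext i j
      simp [Matrix.sum_apply, secondMoment, Matrix.one_apply, Pi.single_apply]
    have hk : ∀ k : Fin n, Tendsto (fun t => ((krausOp ((S.toMoment S₀).cl K) ^ t)
        (secondMoment μ fun _ : Ω => (Pi.single k 1 : Fin n → ℝ))).trace) atTop (𝓝 0) := by
      intro k
      have hx := isInitialState_const (μ := μ) (δ := δ) (γ := γ) (Pi.single k 1 : Fin n → ℝ)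
      have hsum := tendsto_finsetSum Finset.univ fun i _ => hK _ hx i i
      rw [Finset.sum_const_zero] at hsum
      refine hsum.congr fun t => ?_
      rw [← h.secondMoment_state hx S₀]
      rfl
    rw [hone]
    simp only [map_sum, Matrix.trace_sum]
    simpa using tendsto_finsetSum Finset.univ fun k _ => hk k
  · intro hK x hx i j
    refine (tendsto_entry (hK (secondMoment μ x)) i j).congr fun t => ?_
    rw [← h.secondMoment_state hx S₀]
    rfl

lemma stageCost_eq_form (S : LQRm n m p q) (S₀ : Matrix (Fin n) (Fin n) ℝ)
    (K : Matrix (Fin m) (Fin n) ℝ) (v : Fin n → ℝ) :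
    S.stageCost v (K *ᵥ v) = v ⬝ᵥ (S.toMoment S₀).stageMat K *ᵥ v := by
  rw [stageCost, MomentLQR.stageMat, Matrix.add_mulVec, dotProduct_add]
  congr 1
  rw [← Matrix.mulVec_mulVec, ← Matrix.mulVec_mulVec, Matrix.dotProduct_mulVec v,
    Matrix.vecMul_transpose]
  rfl

lemma tendsto_sum_trace {C : Option (Fin p ⊕ Fin q) → Matrix (Fin n) (Fin n) ℝ} (hC : Stable C)
    (M X : Matrix (Fin n) (Fin n) ℝ) :
    Tendsto (fun N => ∑ t ∈ Finset.range N, (M * (krausOp C ^ t) X).trace) atTop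
      (𝓝 (M * lyap C X).trace) := by
  have hc : Continuous fun Z : Matrix (Fin n) (Fin n) ℝ => (M * Z).trace := by fun_prop
  have := (hc.tendsto _).comp (hC.tendsto_sum X)
  refine this.congr fun N => ?_
  simp [Matrix.mul_sum, Matrix.trace_sum]

/-- For a mean-square stabilizing gain the cost is finite and equals the deterministic one. -/
lemma IsNoise.costE_eq (h : S.IsNoise μ δ γ) (hx : IsInitialState μ δ γ x) (hQ : S.Q.PosSemidef)
    (hR : S.R.PosSemidef) (hK : Stable ((S.toMoment (secondMoment μ x)).cl K)) :
    S.costE μ δ γ x K = ENNReal.ofReal ((S.toMoment (secondMoment μ x)).cost K) := by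
  set L := S.toMoment (secondMoment μ x)
  have hst : (L.stageMat K).PosSemidef :=
    hQ.add (MomentLQR.posSemidef_conj_transpose hR K)
  have hnn : ∀ v, 0 ≤ v ⬝ᵥ L.stageMat K *ᵥ v := form_nonneg hst
  have hI := fun t => integral_form (fun i => h.memLp_state (K := K) hx t i) (L.stageMat K)
  rw [costE]
  simp only [S.stageCost_eq_form (secondMoment μ x)]
  rw [lintegral_tsum fun t => (hI t).1.aemeasurable.ennreal_ofReal]
  have e : ∀ t, ∫⁻ ω, ENNReal.ofReal (S.state δ γ K x t ω ⬝ᵥ L.stageMat K *ᵥ S.state δ γ K x t ω) ∂μ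
      = ENNReal.ofReal ((L.stageMat K * (krausOp (L.cl K) ^ t) (secondMoment μ x)).trace) := by
    intro t
    rw [← ofReal_integral_eq_lintegral_ofReal (hI t).1 (Eventually.of_forall fun ω => hnn _),
      (hI t).2, h.secondMoment_state hx (secondMoment μ x)]
  have hpos : ∀ t, 0 ≤ (L.stageMat K * (krausOp (L.cl K) ^ t) (secondMoment μ x)).trace := by
    intro t
    rw [← h.secondMoment_state hx (secondMoment μ x), ← (hI t).2]
    exact integral_nonneg fun ω => hnn _
  have hsum := (hasSum_iff_tendsto_nat_of_nonneg hpos _).mpr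
    (tendsto_sum_trace hK (L.stageMat K) (secondMoment μ x))
  simp only [e]
  rw [← ENNReal.ofReal_tsum_of_nonneg hpos hsum.summable, hsum.tsum_eq]
  rfl

/-- For a mean-square stabilizing gain the aggregate second moment solves the Lyapunov equation;
sum and expectation may be exchanged because the diagonal entries are summable. -/
lemma IsNoise.aggCov_eq (h : S.IsNoise μ δ γ) (hx : IsInitialState μ δ γ x)
    (hK : Stable ((S.toMoment (secondMoment μ x)).cl K)) :
    S.aggCov μ δ γ x K = (S.toMoment (secondMoment μ x)).cov K := by
  set L := S.toMoment (secondMoment μ x)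
  have hM : ∀ t i j, ∫ ω, S.state δ γ K x t ω i * S.state δ γ K x t ω j ∂μ =
      ((krausOp (L.cl K) ^ t) (secondMoment μ x)) i j := by
    intro t i j
    rw [← h.secondMoment_state hx (secondMoment μ x)]; rfl
  have hlim : ∀ i j, Tendsto (fun N => ∑ t ∈ Finset.range N,
      ((krausOp (L.cl K) ^ t) (secondMoment μ x)) i j) atTop (𝓝 (L.cov K i j)) := by
    intro i j
    refine (tendsto_entry (hK.tendsto_sum (secondMoment μ x)) i j).congr fun N => ?_
    rw [Matrix.sum_apply]
  have hdiag : ∀ i, Summable fun t => ((krausOp (L.cl K) ^ t) (secondMoment μ x)) i i := by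
    intro i
    refine ((hasSum_iff_tendsto_nat_of_nonneg (fun t => ?_) _).mpr (hlim i i)).summable
    rw [← hM]
    exact integral_nonneg fun ω => mul_self_nonneg _
  ext i j
  have hsum : Summable fun t => ∫ ω, ‖S.state δ γ K x t ω i * S.state δ γ K x t ω j‖ ∂μ := by
    refine Summable.of_nonneg_of_le (fun t => integral_nonneg fun ω => norm_nonneg _) (fun t => ?_)
      ((hdiag i).add (hdiag j))
    rw [← hM, ← hM, ← integral_add (integrable_state_mul h hx t i i)
      (integrable_state_mul h hx t j j)]
    refine integral_mono (integrable_state_mul h hx t i j).norm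
      ((integrable_state_mul h hx t i i).add (integrable_state_mul h hx t j j)) fun ω => ?_
    simp only [Real.norm_eq_abs]
    rw [abs_le]
    constructor <;> nlinarith [sq_nonneg (S.state δ γ K x t ω i + S.state δ γ K x t ω j),
      sq_nonneg (S.state δ γ K x t ω i - S.state δ γ K x t ω j),
      mul_self_nonneg (S.state δ γ K x t ω i), mul_self_nonneg (S.state δ γ K x t ω j)]
  have hs := hasSum_integral_of_summable_integral_norm
    (fun t => integrable_state_mul (K := K) h hx t i j) hsum
  simp only [hM] at hs
  rw [aggCov, Matrix.of_apply]
  exact tendsto_nhds_unique hs.tendsto_sum_nat (hlim i j)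

end LQRm

namespace LQRm

/-! ### From the moment problem to the stochastic one -/

/-- The polynomial whose reciprocal bounds the step size: `uniformStepBound` in the nine
scalars of `sizeVector`. -/
def stepPoly : MvPolynomial (Fin 9) ℝ :=
  MomentLQR.uniformStepBound (MvPolynomial.X 0 ^ 2 + MvPolynomial.X 2)
    (MvPolynomial.X 1 ^ 2 + MvPolynomial.X 3) (MvPolynomial.X 4) (MvPolynomial.X 5)
    (MvPolynomial.X 6) (MvPolynomial.X 7) (MvPolynomial.X 8)

lemma eval_stepPoly (v : Fin 9 → ℝ) : MvPolynomial.eval v stepPoly =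
    MomentLQR.uniformStepBound (v 0 ^ 2 + v 2) (v 1 ^ 2 + v 3) (v 4) (v 5) (v 6) (v 7) (v 8) := by
  simp [stepPoly, MomentLQR.uniformStepBound, MomentLQR.stepBound, MomentLQR.covBound,
    MomentLQR.defectBound]

variable {n m p q : ℕ} {Ω : Type*} [MeasurableSpace Ω] {μ : Measure Ω}
  {S : LQRm n m p q} {δ : Fin p → ℕ → Ω → ℝ} {γ : Fin q → ℕ → Ω → ℝ}
  {K K₀ Ks : Matrix (Fin m) (Fin n) ℝ} {x : Ω → Fin n → ℝ}

lemma IsNoise.sqA_toMoment (h : S.IsNoise μ δ γ) (S₀ : Matrix (Fin n) (Fin n) ℝ) :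
    (S.toMoment S₀).sqA = specNorm S.A ^ 2 + ∑ i, S.α i * specNorm (S.Ai i) ^ 2 := by
  have hα : ∀ i, 0 ≤ S.α i := fun i => h.coefVar_nonneg (some (Sum.inl i))
  simp [MomentLQR.sqA, toMoment, Fintype.sum_option, specNorm_smul, specNorm_zero, mul_pow,
    Real.sq_sqrt (hα _)]

lemma IsNoise.sqB_toMoment (h : S.IsNoise μ δ γ) (S₀ : Matrix (Fin n) (Fin n) ℝ) :
    (S.toMoment S₀).sqB = specNorm S.B ^ 2 + ∑ j, S.β j * specNorm (S.Bj j) ^ 2 := by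
  have hβ : ∀ j, 0 ≤ S.β j := fun j => h.coefVar_nonneg (some (Sum.inr j))
  simp [MomentLQR.sqB, toMoment, Fintype.sum_option, specNorm_smul, specNorm_zero, mul_pow,
    Real.sq_sqrt (hβ _)]

lemma IsNoise.eval_stepPoly_sizeVector (h : S.IsNoise μ δ γ) (τ : ℝ) :
    MvPolynomial.eval (S.sizeVector μ δ γ x K₀ τ) stepPoly =
      MomentLQR.uniformStepBound (S.toMoment (secondMoment μ x)).sqA
        (S.toMoment (secondMoment μ x)).sqB (specNorm S.R) (sigmaMin S.R)⁻¹
        (sigmaMin (secondMoment μ x))⁻¹ (S.J μ δ γ x K₀) τ := by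
  rw [eval_stepPoly, h.sqA_toMoment, h.sqB_toMoment]
  rfl

lemma IsNoise.eval_stepPoly_pos (h : S.IsNoise μ δ γ) {τ : ℝ} (hτ : 0 ≤ τ) :
    0 < MvPolynomial.eval (S.sizeVector μ δ γ x K₀ τ) stepPoly := by
  rw [h.eval_stepPoly_sizeVector]
  exact MomentLQR.uniformStepBound_pos MomentLQR.sqA_nonneg MomentLQR.sqB_nonneg
    (specNorm_nonneg _) (inv_nonneg.mpr (sigmaMin_nonneg _)) (inv_nonneg.mpr (sigmaMin_nonneg _))
    ENNReal.toReal_nonneg hτ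

variable [IsProbabilityMeasure μ]

/-- If there is only one gain, there is nothing to show beyond finiteness of its cost. -/
lemma linearConvergenceUpTo_of_subsingleton [Subsingleton (Matrix (Fin m) (Fin n) ℝ)]
    (hN : S.IsNoise μ δ γ) (hx : IsInitialState μ δ γ x) (hQ : S.Q.PosSemidef)
    (hR : S.R.PosSemidef) (hK₀ : S.MSStabilizing μ δ γ K₀) {c : ℝ} (hc : 0 < c) :
    S.LinearConvergenceUpTo μ δ γ x K₀ Ks c := by
  have all : ∀ K : Matrix (Fin m) (Fin n) ℝ, K = Ks := fun K => Subsingleton.elim _ _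
  have hfin : S.costE μ δ γ x Ks ≠ ⊤ := by
    rw [all K₀, hN.msStabilizing_iff (secondMoment μ x)] at hK₀
    rw [hN.costE_eq hx hQ hR hK₀]
    exact ENNReal.ofReal_ne_top
  refine ⟨hc, fun η _ _ => ⟨fun k => ?_, ?_, ?_⟩⟩
  · rw [all (S.pgIter μ δ γ x η K₀ k), all (S.pgIter μ δ γ x η K₀ (k + 1))]
    refine ⟨all K₀ ▸ hK₀, hfin, ?_, by simp⟩
    have : S.J μ δ γ x = fun _ => S.J μ δ γ x Ks := funext fun K => by rw [all K]
    rw [this]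
    exact differentiableAt_const _
  · exact tendsto_const_nhds.congr fun k => by rw [all (S.pgIter μ δ γ x η K₀ k)]
  · exact tendsto_const_nhds.congr fun k => (all (S.pgIter μ δ γ x η K₀ k)).symm

lemma regular_toMoment (hQ : S.Q.PosSemidef) (hR : S.R.PosDef) {S₀ : Matrix (Fin n) (Fin n) ℝ}
    (hS : S₀.PosDef) (hn : 0 < n) (hm : 0 < m) :
    (S.toMoment S₀).Regular (sigmaMin S.R) (sigmaMin S₀) where
  Q_psd := hQ
  R_psd := hR.posSemidef
  S_psd := hS.posSemidef
  sR_pos := sigmaMin_pos hR hm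
  s₀_pos := sigmaMin_pos hS hn
  R_ge := sigmaMin_form_le hR.posSemidef
  S_ge := sigmaMin_form_le hS.posSemidef

lemma IsNoise.J_eq_cost (hN : S.IsNoise μ δ γ) (hx : IsInitialState μ δ γ x) {sR s₀ : ℝ}
    (hL : (S.toMoment (secondMoment μ x)).Regular sR s₀)
    (hK : Stable ((S.toMoment (secondMoment μ x)).cl K)) :
    S.J μ δ γ x K = (S.toMoment (secondMoment μ x)).cost K := by
  rw [J, hN.costE_eq hx hL.Q_psd hL.R_psd hK, ENNReal.toReal_ofReal (hL.cost_nonneg hK)]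

lemma IsNoise.hasFDerivAt_J (hN : S.IsNoise μ δ γ) (hx : IsInitialState μ δ γ x) {sR s₀ : ℝ}
    (hL : (S.toMoment (secondMoment μ x)).Regular sR s₀)
    (hK : Stable ((S.toMoment (secondMoment μ x)).cl K)) :
    HasFDerivAt (S.J μ δ γ x)
      (MomentLQR.tracePairing ((S.toMoment (secondMoment μ x)).grad K)) K :=
  hL.hasFDerivAt_of_eq_cost hK fun _ hK => hN.J_eq_cost hx hL hK

lemma IsNoise.gradJ_eq (hN : S.IsNoise μ δ γ) (hx : IsInitialState μ δ γ x) {sR s₀ : ℝ}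
    (hL : (S.toMoment (secondMoment μ x)).Regular sR s₀)
    (hK : Stable ((S.toMoment (secondMoment μ x)).cl K)) :
    S.gradJ μ δ γ x K = (S.toMoment (secondMoment μ x)).grad K := by
  ext i j
  rw [gradJ, Matrix.of_apply, ← MomentLQR.tracePairing_single
    ((S.toMoment (secondMoment μ x)).grad K) i j]
  -- The sup norm induces the product topology in which the derivative is taken.
  let _ : NormedAddCommGroup (Matrix (Fin m) (Fin n) ℝ) := Matrix.normedAddCommGroup
  let _ : NormedSpace ℝ (Matrix (Fin m) (Fin n) ℝ) := Matrix.normedSpace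
  have hline : HasDerivAt (fun s : ℝ => K + s • Matrix.single i j (1 : ℝ))
      (Matrix.single i j (1 : ℝ)) 0 := by
    have := ((hasDerivAt_id (0 : ℝ)).smul_const (Matrix.single i j (1 : ℝ))).const_add K
    rwa [one_smul] at this
  have hJ : HasFDerivAt (S.J μ δ γ x)
      (MomentLQR.tracePairing ((S.toMoment (secondMoment μ x)).grad K))
      (K + (0 : ℝ) • Matrix.single i j (1 : ℝ)) := by
    rw [zero_smul, add_zero]
    exact hN.hasFDerivAt_J hx hL hK
  exact (hJ.comp_hasDerivAt (0 : ℝ) hline).deriv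

lemma IsNoise.isOptimalGain_iff (hN : S.IsNoise μ δ γ) (hx : IsInitialState μ δ γ x) {sR s₀ : ℝ}
    (hL : (S.toMoment (secondMoment μ x)).Regular sR s₀) :
    S.IsOptimalGain μ δ γ x Ks ↔ (S.toMoment (secondMoment μ x)).IsOpt Ks := by
  simp only [IsOptimalGain, MomentLQR.IsOpt, hN.msStabilizing_iff (secondMoment μ x)]
  refine and_congr_right fun hKs => forall_congr' fun K => forall_congr' fun hK => ?_
  rw [hN.costE_eq hx hL.Q_psd hL.R_psd hK, hN.costE_eq hx hL.Q_psd hL.R_psd hKs,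
    ENNReal.ofReal_le_ofReal_iff (hL.cost_nonneg hK)]

/-- Convergence of policy gradient descent whenever `τ` bounds the trace of the aggregate second
moment of an optimal gain. -/
theorem linearConvergenceUpTo_stepPoly (hN : S.IsNoise μ δ γ) (hx : IsInitialState μ δ γ x)
    (hQ : S.Q.PosSemidef) (hR : S.R.PosDef) (hS : (secondMoment μ x).PosDef) (hn : 0 < n)
    (hm : 0 < m) (hK₀ : S.MSStabilizing μ δ γ K₀) (hopt : S.IsOptimalGain μ δ γ x Ks) {τ : ℝ}
    (hτ : (S.aggCov μ δ γ x Ks).trace ≤ τ) :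
    S.LinearConvergenceUpTo μ δ γ x K₀ Ks
      (MvPolynomial.eval (S.sizeVector μ δ γ x K₀ τ) stepPoly)⁻¹ := by
  have hL := S.regular_toMoment hQ hR hS hn hm
  rw [hN.isOptimalGain_iff hx hL] at hopt
  rw [hN.msStabilizing_iff (secondMoment μ x)] at hK₀
  rw [hN.aggCov_eq hx hopt.1] at hτ
  obtain ⟨i₀⟩ : Nonempty (Fin n) := ⟨⟨0, hn⟩⟩
  have hcov := hL.cov_psd hopt.1
  have hent : sigmaMin (secondMoment μ x) ≤
      (S.toMoment (secondMoment μ x)).cov Ks i₀ i₀ := by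
    simpa using hL.cov_ge hopt.1 (Pi.single i₀ 1)
  have hτ0 : 0 < τ := (hL.s₀_pos.trans_le hent).trans_le ((diag_le_trace hcov i₀).trans hτ)
  have hσ0 : 0 < specNorm ((S.toMoment (secondMoment μ x)).cov Ks) := by
    have h1 := form_le_specNorm ((S.toMoment (secondMoment μ x)).cov Ks) (Pi.single i₀ 1)
    have h2 : (S.toMoment (secondMoment μ x)).cov Ks i₀ i₀ ≤
      specNorm ((S.toMoment (secondMoment μ x)).cov Ks) := by simpa using h1
    exact (hL.s₀_pos.trans_le hent).trans_le h2
  have hpos := hN.eval_stepPoly_pos (x := x) (K₀ := K₀) hτ0.le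
  refine ⟨inv_pos.mpr hpos, fun η hη hηc => ?_⟩
  have hηb : η * MvPolynomial.eval (S.sizeVector μ δ γ x K₀ τ) stepPoly ≤ 1 := by
    rwa [← le_div_iff₀ hpos, one_div]
  rw [hN.eval_stepPoly_sizeVector, hN.J_eq_cost hx hL hK₀] at hηb
  obtain ⟨h1, h2, h3⟩ := hL.gradient_descent hopt hτ0 hτ hσ0 (form_le_specNorm _) hη
    (u := S.pgIter μ δ γ x η K₀) hηb hK₀ fun k hk => by
      rw [← hN.gradJ_eq hx hL hk]; rfl
  have hJ := fun k => hN.J_eq_cost hx hL (h1 k).1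
  have hJs := hN.J_eq_cost hx hL hopt.1
  refine ⟨fun k => ⟨(hN.msStabilizing_iff (secondMoment μ x)).mpr (h1 k).1, ?_,
    (hN.hasFDerivAt_J hx hL (h1 k).1).differentiableAt, ?_⟩, ?_, h3⟩
  · rw [hN.costE_eq hx hL.Q_psd hL.R_psd (h1 k).1]
    exact ENNReal.ofReal_ne_top
  · rw [hJ, hJ, hJs, hN.aggCov_eq hx hopt.1]
    exact (h1 k).2
  · rw [hJs]
    exact h2.congr fun k => (hJ k).symm

end LQRm

end

theorem mainTheorem1 :
    ∃ P : MvPolynomial (Fin 9) ℝ,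
      ∀ (n m p q : ℕ) (S : LQRm n m p q) (Ω : Type*) [MeasurableSpace Ω]
        (μ : Measure Ω) [IsProbabilityMeasure μ]
        (δ : Fin p → ℕ → Ω → ℝ) (γ : Fin q → ℕ → Ω → ℝ) (x₀ : Ω → Fin n → ℝ)
        (K₀ : Matrix (Fin m) (Fin n) ℝ),
        S.IsNoise μ δ γ → IsInitialState μ δ γ x₀ →
        S.Q.PosSemidef → S.R.PosDef → (secondMoment μ x₀).PosDef →
        S.MSStabilizing μ δ γ K₀ →
        (∀ Kstar : Matrix (Fin m) (Fin n) ℝ, S.IsOptimalGain μ δ γ x₀ Kstar →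
          S.LinearConvergenceUpTo μ δ γ x₀ K₀ Kstar
            (MvPolynomial.eval (S.sizeVector μ δ γ x₀ K₀
              (S.aggCov μ δ γ x₀ Kstar).trace) P)⁻¹) ∧
        (S.Q.PosDef →
          ∃ Kstar : Matrix (Fin m) (Fin n) ℝ, S.IsOptimalGain μ δ γ x₀ Kstar ∧
            S.LinearConvergenceUpTo μ δ γ x₀ K₀ Kstar
              (MvPolynomial.eval (S.sizeVector μ δ γ x₀ K₀
                (S.J μ δ γ x₀ K₀ * (sigmaMin S.Q)⁻¹)) P)⁻¹) := by
  refine ⟨LQRm.stepPoly, fun n m p q S Ω _ μ _ δ γ x₀ K₀ hN hx hQ hR hS hK₀ => ?_⟩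
  -- In dimension zero there is only one gain, and the singular values need not be positive.
  by_cases hdim : 0 < n ∧ 0 < m
  · obtain ⟨hn, hm⟩ := hdim
    refine ⟨fun Ks hopt => LQRm.linearConvergenceUpTo_stepPoly hN hx hQ hR hS hn hm hK₀ hopt le_rfl,
      fun hQ' => ?_⟩
    have hL := S.regular_toMoment hQ hR hS hn hm
    have hK₀' := (hN.msStabilizing_iff (secondMoment μ x₀)).mp hK₀
    have hq := LQRm.sigmaMin_pos hQ' hn
    have hQge := LQRm.sigmaMin_form_le hQ
    obtain ⟨Ks, hKs⟩ := hL.exists_isOpt hq hQge hK₀'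
    have hopt := (hN.isOptimalGain_iff hx hL).mpr hKs
    refine ⟨Ks, hopt, LQRm.linearConvergenceUpTo_stepPoly hN hx hQ hR hS hn hm hK₀ hopt ?_⟩
    rw [hN.aggCov_eq hx hKs.1, hN.J_eq_cost hx hL hK₀', ← div_eq_mul_inv, le_div_iff₀ hq, mul_comm]
    exact (hL.trace_cov_le_of_Q_ge hQge hKs.1).trans (hKs.2 K₀ hK₀')
  · have hsub : Subsingleton (Matrix (Fin m) (Fin n) ℝ) := by
      refine ⟨fun M N => ?_⟩
      ext i j
      exact absurd ⟨j.pos, i.pos⟩ hdim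
    refine ⟨fun Ks hopt => ?_, fun _ => ⟨K₀, ⟨hK₀, fun K' _ => ?_⟩, ?_⟩⟩
    · refine LQRm.linearConvergenceUpTo_of_subsingleton hN hx hQ hR.posSemidef hK₀
        (inv_pos.mpr (hN.eval_stepPoly_pos ?_))
      have hKs := (hN.msStabilizing_iff (secondMoment μ x₀)).mp hopt.1
      rw [hN.aggCov_eq hx hKs]
      exact (hKs.lyap_posSemidef hS.posSemidef).trace_nonneg
    · rw [Subsingleton.elim K' K₀]
    · exact LQRm.linearConvergenceUpTo_of_subsingleton hN hx hQ hR.posSemidef hK₀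
        (inv_pos.mpr (hN.eval_stepPoly_pos
          (mul_nonneg ENNReal.toReal_nonneg (inv_nonneg.mpr (LQRm.sigmaMin_nonneg _)))))
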